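/- Let $p$ be an odd prime, let $F/\mathbf{Q}_p$ be the unramified quadratic extension with ring of integers $\mathcal{O}_F$, and write $K=\mathrm{GL}_2(\mathcal{O}_F)$. Let $\mathcal{S}(\mathbf{Q}_p^2)$ be the space of locally constant, compactly supported functions $\mathbf{Q}_p^2\to\mathbf{C}$, and let $C_c^\infty(\mathrm{GL}_2(F)/K)$ be the space of locally constant, compactly supported, right $K$-invariant functions $\mathrm{GL}_2(F)\to\mathbf{C}$. Let $\gamma\in\mathrm{GL}_2(\mathbf{Q}_p)$ act on $\mathcal{S}(\mathbf{Q}_p^2)\otimes_{\mathbf{C}} C_c^\infty(\mathrm{GL}_2(F)/K)$ by $\gamma\cdot(\phi\otimes\xi)=\phi((-)\gamma)\otimes\xi(\gamma^{-1}(-))$ (elements of $\mathbf{Q}_p^2$ being row vectors), and let $$\mathcal{I}(\mathrm{GL}_2(F)/K)=\left(\mathcal{S}(\mathbf{Q}_p^2)\otimes_{\mathbf{C}} C_c^\infty(\mathrm{GL}_2(F)/K)\right)_{\mathrm{GL}_2(\mathbf{Q}_p)}$$ be the space of coinvariants. Let $\mathcal{H}^\circ_{\mathrm{GL}_2(F)}=C_c^\infty(K\backslash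 \mathrm{GL}_2(F)/K)$ be the algebra of locally constant, compactly supported, $K$-bi-invariant functions $\mathrm{GL}_2(F)\to\mathbf{C}$ under convolution with respect to the Haar measure $dg$ on $\mathrm{GL}_2(F)$ that gives $K$ volume $1$. It acts on $\mathcal{I}(\mathrm{GL}_2(F)/K)$ through right translation: $\theta\cdot[\phi\otimes\xi]=[\phi\otimes(\theta\cdot\xi)]$, where $(\theta\cdot\xi)(x)=\int_{\mathrm{GL}_2(F)}\theta(g)\,\xi(xg)\,dg$. Then the $\mathcal{H}^\circ_{\mathrm{GL}_2(F)}$-module $\mathcal{I}(\mathrm{GL}_2(F)/K)$ is cyclic, generated by the class of $\mathrm{ch}(\mathbf{Z}_p^2)\otimes\mathrm{ch}(K)$, where $\mathrm{ch}$ denotes a characteristic function. -/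

import Mathlib

open MeasureTheory
open scoped TensorProduct

namespace AsaiHecke

noncomputable section

section General

/-- `C_c^∞(X)`: the locally constant, compactly supported functions `X → ℂ`. -/
def smoothCc (X : Type*) [TopologicalSpace X] : Submodule ℂ (X → ℂ) where
  carrier := {f | IsLocallyConstant f ∧ HasCompactSupport f}
  zero_mem' := ⟨IsLocallyConstant.const 0, HasCompactSupport.zero⟩
  add_mem' := fun ha hb => ⟨ha.1.add hb.1, ha.2.add hb.2⟩
  smul_mem' := fun c _ hf => ⟨hf.1.comp (fun z => c • z), hf.2.smul_left (f := fun _ => c)⟩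

variable {G : Type*} [Group G] [TopologicalSpace G]

/-- A compact open subgroup. -/
structure LevelSubgroup (G : Type*) [Group G] [TopologicalSpace G] extends Subgroup G where
  isOpen' : IsOpen carrier
  isCompact' : IsCompact carrier

/-- `C_c^∞(G / K)`: the locally constant, compactly supported functions on `G` that are
right `K`-invariant. -/
def rightInvCc (K : LevelSubgroup G) : Submodule ℂ (G → ℂ) where
  carrier := {f | f ∈ smoothCc G ∧ ∀ g, ∀ k ∈ K.toSubgroup, f (g * k) = f g}
  zero_mem' := ⟨Submodule.zero_mem _, fun _ _ _ => rfl⟩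
  add_mem' := fun ha hb => ⟨Submodule.add_mem _ ha.1 hb.1, fun g k hk => by
    simp [ha.2 g k hk, hb.2 g k hk]⟩
  smul_mem' := fun c f hf => ⟨Submodule.smul_mem _ c hf.1, fun g k hk => by
    simp [hf.2 g k hk]⟩

/-- `C_c^∞(K \ G / K)`: the locally constant, compactly supported, `K`-bi-invariant functions. -/
def biInvCc (K : LevelSubgroup G) : Submodule ℂ (G → ℂ) where
  carrier := {f | f ∈ rightInvCc K ∧ ∀ g, ∀ k ∈ K.toSubgroup, f (k * g) = f g}
  zero_mem' := ⟨Submodule.zero_mem _, fun _ _ _ => rfl⟩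
  add_mem' := fun ha hb => ⟨Submodule.add_mem _ ha.1 hb.1, fun g k hk => by
    simp [ha.2 g k hk, hb.2 g k hk]⟩
  smul_mem' := fun c f hf => ⟨Submodule.smul_mem _ c hf.1, fun g k hk => by
    simp [hf.2 g k hk]⟩

/-- The characteristic function `ch(K)`. -/
def chFun (K : LevelSubgroup G) : G → ℂ := Set.indicator (K.toSubgroup : Set G) 1

variable [IsTopologicalGroup G]

theorem isLocallyConstant_of_right_inv (K : LevelSubgroup G) {f : G → ℂ}
    (hf : ∀ g, ∀ k ∈ K.toSubgroup, f (g * k) = f g) : IsLocallyConstant f := by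
  rw [IsLocallyConstant.iff_exists_open]
  intro x
  refine ⟨(fun y => x⁻¹ * y) ⁻¹' (K.toSubgroup : Set G),
    K.isOpen'.preimage (continuous_const_mul x⁻¹), ?_, fun y hy => ?_⟩
  · simp [K.toSubgroup.one_mem]
  · have := hf x (x⁻¹ * y) hy
    simpa using this

theorem chFun_mem (K : LevelSubgroup G) : chFun K ∈ biInvCc K := by
  have hr : ∀ g, ∀ k ∈ K.toSubgroup, chFun K (g * k) = chFun K g := fun g k hk => by
    have := K.toSubgroup.mul_mem_cancel_right (y := g) hk
    by_cases h : g ∈ K.toSubgroup <;> simp_all [chFun, Set.indicator]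
  refine ⟨⟨⟨isLocallyConstant_of_right_inv K hr, ?_⟩, hr⟩, fun g k hk => ?_⟩
  · exact HasCompactSupport.intro K.isCompact' fun x hx => Set.indicator_of_notMem hx _
  · have := K.toSubgroup.mul_mem_cancel_left (y := g) hk
    by_cases h : g ∈ K.toSubgroup <;> simp_all [chFun, Set.indicator]

variable [MeasurableSpace G] [BorelSpace G]

/-- The left Haar measure on `G` that gives `K` volume `1`. -/
def LevelSubgroup.haar (K : LevelSubgroup G) : Measure G :=
  Measure.haarMeasure ⟨⟨(K.toSubgroup : Set G), K.isCompact'⟩,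
    ⟨1, by
      have h : interior (K.toSubgroup : Set G) = K.toSubgroup := K.isOpen'.interior_eq
      exact h.symm ▸ K.toSubgroup.one_mem⟩⟩

instance (K : LevelSubgroup G) : K.haar.IsHaarMeasure := by
  unfold LevelSubgroup.haar; infer_instance

theorem LevelSubgroup.haar_self (K : LevelSubgroup G) :
    K.haar (K.toSubgroup : Set G) = 1 := Measure.haarMeasure_self

/-- Convolution, `(a * b)(x) = ∫ a(g) b(g⁻¹ x) dg`. -/
def convFun (K : LevelSubgroup G) (a b : G → ℂ) (x : G) : ℂ :=
  ∫ g, a g * b (g⁻¹ * x) ∂K.haar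

/-- The operator obtained by integrating right translation, `(θ · ξ)(x) = ∫ θ(g) ξ(x g) dg`. -/
def actFun (K : LevelSubgroup G) (a f : G → ℂ) (x : G) : ℂ :=
  ∫ g, a g * f (x * g) ∂K.haar

theorem integrable_mul (K : LevelSubgroup G) {a f : G → ℂ} (ha : a ∈ smoothCc G)
    (hf : Continuous f) : Integrable (fun g => a g * f g) K.haar :=
  (ha.1.continuous.mul hf).integrable_of_hasCompactSupport (ha.2.mul_right)

theorem integral_conv_mul (K : LevelSubgroup G) {a b f : G → ℂ} (ha : a ∈ smoothCc G)
    (hb : b ∈ smoothCc G) (hf : Continuous f) :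
    ∫ g, convFun K a b g * f g ∂K.haar = ∫ h, a h * ∫ g, b g * f (h * g) ∂K.haar ∂K.haar := by
  have h1 : ∀ h, ∫ g, b g * f (h * g) ∂K.haar = ∫ g, b (h⁻¹ * g) * f g ∂K.haar := fun h => by
    rw [← integral_mul_left_eq_self (fun g => b (h⁻¹ * g) * f g) h]
    simp
  simp only [h1, convFun, ← integral_const_mul, ← integral_mul_const]
  have hac := ha.1.continuous
  have hbc := hb.1.continuous
  rw [integral_integral_swap_of_hasCompactSupport]
  · simp only [mul_assoc]
  · simp only [Function.uncurry_def]
    fun_prop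
  · refine HasCompactSupport.intro (K := (fun q : G × G => (q.1 * q.2, q.1)) ''
      (tsupport a ×ˢ tsupport b)) ((ha.2.isCompact.prod hb.2.isCompact).image (by fun_prop)) ?_
    rintro ⟨g, h⟩ hgh
    by_contra hne
    apply hgh
    have h2 : a h ≠ 0 ∧ b (h⁻¹ * g) ≠ 0 := by
      constructor <;> intro h0 <;> simp [h0] at hne
    exact ⟨(h, h⁻¹ * g), ⟨subset_tsupport _ h2.1, subset_tsupport _ h2.2⟩, by simp⟩

theorem convFun_mem (K : LevelSubgroup G) {a b : G → ℂ} (ha : a ∈ biInvCc K)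
    (hb : b ∈ biInvCc K) : convFun K a b ∈ biInvCc K := by
  have hr : ∀ g, ∀ k ∈ K.toSubgroup, convFun K a b (g * k) = convFun K a b g := fun g k hk => by
    simp only [convFun, ← mul_assoc, hb.1.2 _ k hk]
  refine ⟨⟨⟨isLocallyConstant_of_right_inv K hr, ?_⟩, hr⟩, fun x k hk => ?_⟩
  · refine HasCompactSupport.intro (ha.1.1.2.isCompact.mul hb.1.1.2.isCompact) fun x hx => ?_
    have : ∀ g, a g * b (g⁻¹ * x) = 0 := fun g => by
      by_contra hne
      exact hx ⟨g, subset_tsupport _ (left_ne_zero_of_mul hne), g⁻¹ * x,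
        subset_tsupport _ (right_ne_zero_of_mul hne), by simp⟩
    simp [convFun, this]
  · simp only [convFun]
    rw [← integral_mul_left_eq_self _ k]
    simp only [ha.2 _ k hk, mul_inv_rev, mul_assoc, inv_mul_cancel_left]

theorem actFun_mem (K : LevelSubgroup G) {a f : G → ℂ} (ha : a ∈ biInvCc K)
    (hf : f ∈ rightInvCc K) : actFun K a f ∈ rightInvCc K := by
  have hr : ∀ g, ∀ k ∈ K.toSubgroup, actFun K a f (g * k) = actFun K a f g := fun x k hk => by
    simp only [actFun]
    rw [← integral_mul_left_eq_self (fun g => a g * f (x * g)) k]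
    simp only [ha.2 _ k hk, mul_assoc]
  refine ⟨⟨isLocallyConstant_of_right_inv K hr, ?_⟩, hr⟩
  refine HasCompactSupport.intro (hf.1.2.isCompact.mul ha.1.1.2.isCompact.inv) fun x hx => ?_
  have : ∀ g, a g * f (x * g) = 0 := fun g => by
    by_contra hne
    exact hx ⟨x * g, subset_tsupport _ (right_ne_zero_of_mul hne), g⁻¹,
      by simpa using subset_tsupport _ (left_ne_zero_of_mul hne), by simp⟩
  simp [actFun, this]

theorem integral_ch_mul (K : LevelSubgroup G) (f : G → ℂ) (c : ℂ)
    (hf : ∀ k ∈ K.toSubgroup, f k = c) : ∫ g, chFun K g * f g ∂K.haar = c := by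
  have h : (fun g => chFun K g * f g) = Set.indicator (K.toSubgroup : Set G) (fun _ => c) := by
    funext g
    by_cases hg : g ∈ (K.toSubgroup : Set G)
    · simp [chFun, hg, hf g hg]
    · simp [chFun, hg]
  have hm : MeasurableSet (K.toSubgroup : Set G) := IsOpen.measurableSet K.isOpen'
  rw [h, integral_indicator hm]
  simp [Measure.real, K.haar_self]

/-- The Hecke algebra `C_c^∞(K \ G / K)`, with convolution (for the Haar measure giving `K`
volume `1`) as its multiplication. -/
def HeckeAlg (K : LevelSubgroup G) : Type _ := ↥(biInvCc K)

instance (K : LevelSubgroup G) : AddCommGroup (HeckeAlg K) :=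
  inferInstanceAs (AddCommGroup ↥(biInvCc K))

instance (K : LevelSubgroup G) : Ring (HeckeAlg K) where
  __ := (inferInstance : AddCommGroup (HeckeAlg K))
  mul a b := ⟨convFun K a.1 b.1, convFun_mem K a.2 b.2⟩
  one := ⟨chFun K, chFun_mem K⟩
  left_distrib a b c := Subtype.ext <| funext fun x => by
    have hb : Continuous fun g => b.1 (g⁻¹ * x) := by
      have := b.2.1.1.1.continuous; fun_prop
    have hc : Continuous fun g => c.1 (g⁻¹ * x) := by
      have := c.2.1.1.1.continuous; fun_prop
    refine Eq.trans ?_ (integral_add (integrable_mul K a.2.1.1 hb) (integrable_mul K a.2.1.1 hc))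
    exact integral_congr_ae (Filter.Eventually.of_forall fun g => mul_add _ _ _)
  right_distrib a b c := Subtype.ext <| funext fun x => by
    have hc : Continuous fun g => c.1 (g⁻¹ * x) := by
      have := c.2.1.1.1.continuous; fun_prop
    refine Eq.trans ?_ (integral_add (integrable_mul K a.2.1.1 hc) (integrable_mul K b.2.1.1 hc))
    exact integral_congr_ae (Filter.Eventually.of_forall fun g => add_mul _ _ _)
  zero_mul a := Subtype.ext <| funext fun x => by
    refine Eq.trans ?_ (integral_zero G ℂ (μ := K.haar))
    exact integral_congr_ae (Filter.Eventually.of_forall fun g => zero_mul _)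
  mul_zero a := Subtype.ext <| funext fun x => by
    refine Eq.trans ?_ (integral_zero G ℂ (μ := K.haar))
    exact integral_congr_ae (Filter.Eventually.of_forall fun g => mul_zero _)
  mul_assoc a b c := Subtype.ext <| funext fun x => by
    have hc : Continuous fun g => c.1 (g⁻¹ * x) := by
      have := c.2.1.1.1.continuous; fun_prop
    refine (integral_conv_mul K a.2.1.1 b.2.1.1 hc).trans ?_
    refine integral_congr_ae (Filter.Eventually.of_forall fun g => ?_)
    change _ = a.1 g * ∫ h, b.1 h * c.1 (h⁻¹ * (g⁻¹ * x)) ∂K.haar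
    simp only [mul_inv_rev, mul_assoc]
  one_mul a := Subtype.ext <| funext fun x =>
    integral_ch_mul K _ _ fun k hk => a.2.2 x k⁻¹ (K.toSubgroup.inv_mem hk)
  mul_one a := Subtype.ext <| funext fun x => by
    change ∫ g, a.1 g * chFun K (g⁻¹ * x) ∂K.haar = a.1 x
    rw [← integral_mul_left_eq_self _ x, ← integral_ch_mul K (fun g => a.1 (x * g)) (a.1 x)
      (fun k hk => a.2.1.2 x k hk)]
    refine integral_congr_ae (Filter.Eventually.of_forall fun g => ?_)
    have : chFun K (g⁻¹) = chFun K g := by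
      by_cases h : g ∈ K.toSubgroup <;> simp [chFun, Set.indicator, h]
    simp [this, mul_comm]

/-- The action of the Hecke algebra on `C_c^∞(G / K)` by right translation. -/
def heckeAct (K : LevelSubgroup G) : HeckeAlg K →+* Module.End ℂ ↥(rightInvCc K) where
  toFun a :=
    { toFun := fun f => ⟨actFun K a.1 f.1, actFun_mem K a.2 f.2⟩
      map_add' := fun f h => Subtype.ext <| funext fun x => by
        have hf : Continuous fun g => f.1 (x * g) := by
          have := f.2.1.1.continuous; fun_prop
        have hh : Continuous fun g => h.1 (x * g) := by
          have := h.2.1.1.continuous; fun_prop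
        refine Eq.trans ?_
          (integral_add (integrable_mul K a.2.1.1 hf) (integrable_mul K a.2.1.1 hh))
        exact integral_congr_ae (Filter.Eventually.of_forall fun g => mul_add _ _ _)
      map_smul' := fun c f => Subtype.ext <| funext fun x => by
        refine Eq.trans ?_ (integral_const_mul c _)
        exact integral_congr_ae (Filter.Eventually.of_forall fun g => mul_left_comm _ _ _) }
  map_zero' := LinearMap.ext fun f => Subtype.ext <| funext fun x => by
    refine Eq.trans ?_ (integral_zero G ℂ (μ := K.haar))
    exact integral_congr_ae (Filter.Eventually.of_forall fun g => zero_mul _)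
  map_add' a b := LinearMap.ext fun f => Subtype.ext <| funext fun x => by
    have hf : Continuous fun g => f.1 (x * g) := by
      have := f.2.1.1.continuous; fun_prop
    refine Eq.trans ?_ (integral_add (integrable_mul K a.2.1.1 hf) (integrable_mul K b.2.1.1 hf))
    exact integral_congr_ae (Filter.Eventually.of_forall fun g => add_mul _ _ _)
  map_one' := LinearMap.ext fun f => Subtype.ext <| funext fun x =>
    integral_ch_mul K _ _ fun k hk => f.2.2 x k hk
  map_mul' a b := LinearMap.ext fun f => Subtype.ext <| funext fun x => by
    have hf : Continuous fun g => f.1 (x * g) := by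
      have := f.2.1.1.continuous; fun_prop
    refine (integral_conv_mul K a.2.1.1 b.2.1.1 hf).trans ?_
    refine integral_congr_ae (Filter.Eventually.of_forall fun g => ?_)
    change _ = a.1 g * ∫ h, b.1 h * f.1 (x * g * h) ∂K.haar
    simp only [mul_assoc]

end General

section Coinvariants

variable (p : ℕ) [Fact p.Prime]

/-- `(γ · φ)(v) = φ(v γ)` (row vectors) on the Schwartz space `S(ℚ_p²) = C_c^∞(ℚ_p²)`. -/
def schwartzRep :
    Representation ℂ (GL (Fin 2) ℚ_[p]) ↥(smoothCc (Fin 2 → ℚ_[p])) where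
  toFun γ :=
    { toFun := fun φ => ⟨fun v => φ.1 (Matrix.vecMul v (γ : Matrix (Fin 2) (Fin 2) ℚ_[p])), by
        have hc : ∀ M : Matrix (Fin 2) (Fin 2) ℚ_[p],
            Continuous fun v : Fin 2 → ℚ_[p] => Matrix.vecMul v M := fun M =>
          continuous_id.matrix_vecMul continuous_const
        refine ⟨φ.2.1.comp_continuous (hc _), ?_⟩
        refine HasCompactSupport.intro (φ.2.2.isCompact.image
          (hc ((γ⁻¹ : GL (Fin 2) ℚ_[p]) : Matrix (Fin 2) (Fin 2) ℚ_[p]))) fun v hv => ?_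
        by_contra hne
        refine hv ⟨_, subset_tsupport _ hne, ?_⟩
        simp [Matrix.vecMul_vecMul]⟩
      map_add' := fun _ _ => rfl
      map_smul' := fun _ _ => rfl }
  map_one' := by
    ext φ v
    simp
  map_mul' a b := by
    ext φ v
    simp [Matrix.vecMul_vecMul]

variable {G : Type*} [Group G] [TopologicalSpace G] [IsTopologicalGroup G]

/-- `(γ · ξ)(x) = ξ(γ⁻¹ x)` on `C_c^∞(G / K)`, for `γ` acting through `ι : H →* G`. -/
def leftRep {H : Type*} [Group H] (ι : H →* G) (K : LevelSubgroup G) :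
    Representation ℂ H ↥(rightInvCc K) where
  toFun γ :=
    { toFun := fun ξ => ⟨fun x => ξ.1 ((ι γ)⁻¹ * x),
        ⟨ξ.2.1.1.comp_continuous (continuous_const_mul _),
          ξ.2.1.2.comp_homeomorph (Homeomorph.mulLeft (ι γ)⁻¹)⟩,
        fun g k hk => by simp only [← mul_assoc, ξ.2.2 _ k hk]⟩
      map_add' := fun _ _ => rfl
      map_smul' := fun _ _ => rfl }
  map_one' := by
    ext ξ x
    simp
  map_mul' a b := by
    ext ξ x
    simp [mul_assoc]

/-- `S(ℚ_p²) ⊗ C_c^∞(G / K)`. -/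
def TensorMod (K : LevelSubgroup G) : Type _ :=
  ↥(smoothCc (Fin 2 → ℚ_[p])) ⊗[ℂ] ↥(rightInvCc K)

instance (K : LevelSubgroup G) : AddCommGroup (TensorMod p K) :=
  inferInstanceAs (AddCommGroup (↥(smoothCc (Fin 2 → ℚ_[p])) ⊗[ℂ] ↥(rightInvCc K)))

instance (K : LevelSubgroup G) : Module ℂ (TensorMod p K) :=
  inferInstanceAs (Module ℂ (↥(smoothCc (Fin 2 → ℚ_[p])) ⊗[ℂ] ↥(rightInvCc K)))

/-- The representation `γ · (φ ⊗ ξ) = φ((-)γ) ⊗ ξ(γ⁻¹(-))` of `GL₂(ℚ_p)` on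
`S(ℚ_p²) ⊗ C_c^∞(G / K)`. -/
def tensorRep (ι : GL (Fin 2) ℚ_[p] →* G) (K : LevelSubgroup G) :
    Representation ℂ (GL (Fin 2) ℚ_[p]) (TensorMod p K) :=
  (schwartzRep p).tprod (leftRep ι K)

/-- `I(G / K)`: the `GL₂(ℚ_p)`-coinvariants of `S(ℚ_p²) ⊗ C_c^∞(G / K)`. -/
abbrev CoinvModule (ι : GL (Fin 2) ℚ_[p] →* G) (K : LevelSubgroup G) : Type _ :=
  (tensorRep p ι K).Coinvariants

/-- The class of `φ ⊗ ξ` in the coinvariants. -/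
def coinvClass (ι : GL (Fin 2) ℚ_[p] →* G) (K : LevelSubgroup G)
    (φ : ↥(smoothCc (Fin 2 → ℚ_[p]))) (ξ : ↥(rightInvCc K)) : CoinvModule p ι K :=
  Representation.Coinvariants.mk (tensorRep p ι K) (φ ⊗ₜ[ℂ] ξ)

variable [MeasurableSpace G] [BorelSpace G]

theorem leftRep_heckeAct (ι : GL (Fin 2) ℚ_[p] →* G) (K : LevelSubgroup G) (a : HeckeAlg K)
    (γ : GL (Fin 2) ℚ_[p]) (ξ : ↥(rightInvCc K)) :
    heckeAct K a (leftRep ι K γ ξ) = leftRep ι K γ (heckeAct K a ξ) := by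
  refine Subtype.ext <| funext fun x => ?_
  change ∫ g, a.1 g * ξ.1 ((ι γ)⁻¹ * (x * g)) ∂K.haar =
    ∫ g, a.1 g * ξ.1 ((ι γ)⁻¹ * x * g) ∂K.haar
  simp only [mul_assoc]

/-- The action `θ · (φ ⊗ ξ) = φ ⊗ (θ · ξ)` of the Hecke algebra on `S(ℚ_p²) ⊗ C_c^∞(G / K)`. -/
def tensorAct (K : LevelSubgroup G) : HeckeAlg K →+* Module.End ℂ (TensorMod p K) where
  toFun a := LinearMap.lTensor ↥(smoothCc (Fin 2 → ℚ_[p])) (heckeAct K a)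
  map_one' := by
    rw [map_one]
    exact LinearMap.lTensor_id _ _
  map_mul' a b := by
    rw [map_mul]
    exact LinearMap.lTensor_comp _ _ _
  map_zero' := by
    rw [map_zero]
    exact LinearMap.lTensor_zero _
  map_add' a b := by
    rw [map_add]
    exact LinearMap.lTensor_add _ _ _

theorem tensorRep_tensorAct (ι : GL (Fin 2) ℚ_[p] →* G) (K : LevelSubgroup G) (a : HeckeAlg K)
    (γ : GL (Fin 2) ℚ_[p]) :
    tensorAct p K a ∘ₗ tensorRep p ι K γ = tensorRep p ι K γ ∘ₗ tensorAct p K a := by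
  refine TensorProduct.ext' fun φ ξ => ?_
  exact congrArg (fun z => schwartzRep p γ φ ⊗ₜ[ℂ] z) (leftRep_heckeAct p ι K a γ ξ)

/-- `id ⊗ θ` commutes with `GL₂(ℚ_p)`, so it descends to the coinvariants. -/
def heckeCoinv (ι : GL (Fin 2) ℚ_[p] →* G) (K : LevelSubgroup G) :
    HeckeAlg K →+* Module.End ℂ (CoinvModule p ι K) where
  toFun a := Representation.Coinvariants.lift (tensorRep p ι K)
    (Representation.Coinvariants.mk (tensorRep p ι K) ∘ₗ tensorAct p K a) fun γ => by
      rw [LinearMap.comp_assoc, tensorRep_tensorAct]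
      ext t
      exact Representation.Coinvariants.mk_self_apply (tensorRep p ι K) γ (tensorAct p K a t)
  map_one' := Representation.Coinvariants.hom_ext <| by
    ext t
    simp
  map_mul' a b := Representation.Coinvariants.hom_ext <| by
    ext t
    simp
  map_zero' := Representation.Coinvariants.hom_ext <| by
    ext t
    simp
  map_add' a b := Representation.Coinvariants.hom_ext <| by
    ext t
    simp

/-- The Hecke module structure on the coinvariants, induced by right translation on
`C_c^∞(G / K)`. -/
instance (ι : GL (Fin 2) ℚ_[p] →* G) (K : LevelSubgroup G) :
    Module (HeckeAlg K) (CoinvModule p ι K) :=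
  Module.compHom _ (heckeCoinv p ι K)

theorem smul_coinvClass (ι : GL (Fin 2) ℚ_[p] →* G) (K : LevelSubgroup G) (a : HeckeAlg K)
    (φ : ↥(smoothCc (Fin 2 → ℚ_[p]))) (ξ : ↥(rightInvCc K)) :
    a • coinvClass p ι K φ ξ = coinvClass p ι K φ (heckeAct K a ξ) := rfl

/-- The characteristic function `ch(ℤ_p²)`. -/
def chZp : ↥(smoothCc (Fin 2 → ℚ_[p])) :=
  ⟨Set.indicator {v | ∀ i, ‖v i‖ ≤ 1} 1, by
    have h : {v : Fin 2 → ℚ_[p] | ∀ i, ‖v i‖ ≤ 1} = Metric.closedBall 0 1 := by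
      ext v
      simp [pi_norm_le_iff_of_nonneg]
    rw [h]
    refine ⟨?_, HasCompactSupport.intro (isCompact_closedBall 0 1)
      fun x hx => Set.indicator_of_notMem hx _⟩
    have hc := IsUltrametricDist.isClopen_closedBall (0 : Fin 2 → ℚ_[p]) one_ne_zero
    exact (LocallyConstant.charFn ℂ hc).isLocallyConstant⟩

/-- `ch(K)` as an element of `C_c^∞(G / K)`. -/
def chLevel (K : LevelSubgroup G) : ↥(rightInvCc K) := ⟨chFun K, (chFun_mem K).1⟩

end Coinvariants

section LocalField

variable (p : ℕ) [Fact p.Prime] (F : Type*) [NormedField F] [NormedAlgebra ℚ_[p] F]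

/-- The ring of integers `O_F = {x | ‖x‖ ≤ 1}`. -/
def integers : Subring F where
  carrier := {x | ‖x‖ ≤ 1}
  zero_mem' := by simp
  one_mem' := by simp
  add_mem' := fun {a b} ha hb => by
    have := IsUltrametricDist.of_normedAlgebra ℚ_[p] (L := F)
    exact (IsUltrametricDist.norm_add_le_max a b).trans (max_le ha hb)
  mul_mem' := fun {a b} ha hb => by
    simpa using mul_le_one₀ ha (norm_nonneg b) hb
  neg_mem' := fun {a} ha => by simpa using ha

/-- `F / ℚ_p` is unramified: `p` generates the maximal ideal of `O_F`. (The residue field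
extension is automatically separable, the residue field of `ℚ_p` being finite.) -/
def IsUnramified : Prop := (Ideal.span {(p : integers p F)}).IsMaximal

/-- The subgroup `GL₂(O_F)` of `GL₂(F)`. -/
def GLInt : Subgroup (GL (Fin 2) F) :=
  (Matrix.GeneralLinearGroup.map (n := Fin 2) (integers p F).subtype).range

variable {F} in
theorem mem_GLInt_iff (g : GL (Fin 2) F) :
    g ∈ GLInt p F ↔ (∀ i j, ‖(g : Matrix (Fin 2) (Fin 2) F) i j‖ ≤ 1) ∧
      ∀ i j, ‖((g⁻¹ : GL (Fin 2) F) : Matrix (Fin 2) (Fin 2) F) i j‖ ≤ 1 := by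
  constructor
  · rintro ⟨h, rfl⟩
    refine ⟨fun i j => (h.1 i j).2, fun i j => ?_⟩
    rw [← map_inv]
    exact ((h⁻¹).1 i j).2
  · rintro ⟨h1, h2⟩
    have hinj : Function.Injective
        ((integers p F).subtype.mapMatrix (m := Fin 2)) :=
      Matrix.map_injective Subtype.val_injective
    refine ⟨⟨Matrix.of fun i j => ⟨g.1 i j, h1 i j⟩, Matrix.of fun i j => ⟨(g⁻¹).1 i j, h2 i j⟩,
      hinj ?_, hinj ?_⟩, ?_⟩
    · rw [map_mul, map_one]
      exact g.mul_inv
    · rw [map_mul, map_one]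
      exact g.inv_mul
    · ext i j
      rfl

variable [FiniteDimensional ℚ_[p] F]

/-- `GL₂(O_F)` as a compact open subgroup of `GL₂(F)`. -/
def level : LevelSubgroup (GL (Fin 2) F) where
  toSubgroup := GLInt p F
  isOpen' := by
    have hu := IsUltrametricDist.of_normedAlgebra ℚ_[p] (L := F)
    have hball : IsOpen {x : F | ‖x‖ ≤ 1} := by
      have := (IsUltrametricDist.isClopen_closedBall (0 : F) one_ne_zero).isOpen
      simpa [Metric.closedBall, dist_zero_right] using this
    have hset : (GLInt p F).carrier = (⋂ i, ⋂ j, {g : GL (Fin 2) F | ‖g.1 i j‖ ≤ 1}) ∩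
        ⋂ i, ⋂ j, {g : GL (Fin 2) F | ‖(g⁻¹).1 i j‖ ≤ 1} := by
      ext g
      exact (mem_GLInt_iff p g).trans (by simp)
    rw [hset]
    refine IsOpen.inter ?_ ?_
    · refine isOpen_iInter_of_finite fun i => isOpen_iInter_of_finite fun j => ?_
      exact hball.preimage (Units.continuous_val.matrix_elem i j)
    · refine isOpen_iInter_of_finite fun i => isOpen_iInter_of_finite fun j => ?_
      exact hball.preimage ((Units.continuous_val.comp continuous_inv).matrix_elem i j)
  isCompact' := by
    have hp : ProperSpace F := FiniteDimensional.proper ℚ_[p] F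
    have hB : IsCompact {M : Matrix (Fin 2) (Fin 2) F | ∀ i j, ‖M i j‖ ≤ 1} := by
      have := isCompact_univ_pi fun _ : Fin 2 => isCompact_univ_pi fun _ : Fin 2 =>
        isCompact_closedBall (0 : F) 1
      have he : {M : Matrix (Fin 2) (Fin 2) F | ∀ i j, ‖M i j‖ ≤ 1} =
          Set.univ.pi fun _ : Fin 2 => Set.univ.pi fun _ : Fin 2 =>
            Metric.closedBall (0 : F) 1 := by
        ext M
        refine Iff.trans ?_ (Set.mem_univ_pi (f := (M : Fin 2 → Fin 2 → F))).symm
        simp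
      exact he ▸ this
    rw [Units.isInducing_embedProduct.isCompact_iff]
    have hset : Units.embedProduct (Matrix (Fin 2) (Fin 2) F) '' (GLInt p F).carrier =
        ({M : Matrix (Fin 2) (Fin 2) F | ∀ i j, ‖M i j‖ ≤ 1} ×ˢ
          (MulOpposite.op '' {M : Matrix (Fin 2) (Fin 2) F | ∀ i j, ‖M i j‖ ≤ 1})) ∩
        ({q | q.1 * q.2.unop = 1} ∩ {q | q.2.unop * q.1 = 1}) := by
      ext ⟨A, B⟩
      constructor
      · rintro ⟨g, hg, hgA⟩
        obtain ⟨h1, h2⟩ := (mem_GLInt_iff p g).1 hg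
        obtain ⟨rfl, rfl⟩ := Prod.mk.inj hgA
        exact ⟨⟨h1, _, h2, rfl⟩, g.mul_inv, g.inv_mul⟩
      · rintro ⟨⟨h1, C, h2, rfl⟩, h3, h4⟩
        exact ⟨⟨A, C, h3, h4⟩, (mem_GLInt_iff p _).2 ⟨h1, h2⟩, rfl⟩
    rw [hset]
    refine (hB.prod (hB.image MulOpposite.continuous_op)).inter_right (IsClosed.inter ?_ ?_)
    · exact isClosed_eq (continuous_fst.mul (MulOpposite.continuous_unop.comp continuous_snd))
        continuous_const
    · exact isClosed_eq ((MulOpposite.continuous_unop.comp continuous_snd).mul continuous_fst)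
        continuous_const

end LocalField

end

end AsaiHecke

namespace AsaiHecke

noncomputable section

/-! ### Finite sums of characteristic functions of classes. -/

section FiniteDecomposition

/-! Let N be the Hecke submodule generated by the given class and work modulo N. The classes of φ ⊗
ch(gK) span the coinvariants, so it suffices that each g is `Good`: they all vanish for that g.
`Good` is stable under left translation by GL₂(ℚ_p), right translation by K, and scalars of F, which
are scalars of ℚ_p times units because F/ℚ_p is unramified. Write F = ℚ_p τ + ℚ_p with (τ, 1)
orthonormal. The Iwasawa decomposition and upper triangular matrices over ℚ_p reduce every g to
diag(A, 1), which follows from g = 1, or to g_A = (A, τ; 0, 1).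

Two facts finish the proof. First, for |A| ≤ 1 the group O_F^×, acting on ℚ_p² = F by
multiplication, stabilises g_A K, because (τ, 1) is a common eigenvector. It is transitive on
vectors of a given norm, so φ ↦ [φ ⊗ ch(g_A K)] is determined by balls around the origin
(`functional_eq_zero`). Central Hecke operators reduce these to ch(ℤ_p²), so only one value must be
killed (`IsOrthoGen.good_of_chZp`). With A = 1 this already gives `Good` for g = 1.

Second, that value is killed by induction on the valuation of A. The Hecke operator of diag(p, 1),
applied to ch(ℤ_p²) ⊗ ch(gK) with g = (pⁿ, τ; 0, 1), gives a sum over cosets. Each term is already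
in N or has the same class as the coset of (pⁿ⁺¹, τ; 0, 1) (`IsOrthoGen.classMod_coset`). A positive
integer multiple of the wanted class is thus in N, and so is the class, as the coefficients are
complex (`classMod_double_coset`). No exact count of cosets is needed. -/

/-- A compactly supported function that is constant on the classes of an equivalence relation with
open classes is a finite sum of multiples of characteristic functions of classes. -/
theorem exists_finset_sum_classes {X : Type*} [TopologicalSpace X] (r : Setoid X)
    [∀ x y, Decidable (r x y)] (hopen : ∀ x, IsOpen {y | r x y}) {f : X → ℂ}
    (hf : ∀ x y, r x y → f y = f x) (hc : HasCompactSupport f) :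
    ∃ s : Finset X, (∀ c ∈ s, f c ≠ 0) ∧
      ∀ x, f x = ∑ c ∈ s, f c * (if r c x then 1 else 0) := by
  classical
  obtain ⟨t, ht⟩ := hc.isCompact.elim_finite_subcover (fun x => {y | r x y}) hopen
    fun x _ => Set.mem_iUnion.2 ⟨x, r.refl x⟩
  have hout : ∀ x, r (Quotient.mk r x).out x := fun x => Quotient.mk_out x
  -- Centres of a subcover may repeat a class; replacing each by the chosen representative of its
  -- class makes the sum multiplicity-free.
  refine ⟨(t.image fun x => (Quotient.mk r x).out).filter fun c => f c ≠ 0, fun c hc => by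
    simpa using (Finset.mem_filter.1 hc).2, fun x => ?_⟩
  by_cases hx : f x = 0
  · rw [hx, Finset.sum_eq_zero]
    intro c hc
    have hc0 := (Finset.mem_filter.1 hc).2
    rw [if_neg, mul_zero]
    intro hr
    exact hc0 (hf c x hr ▸ hx)
  · obtain ⟨y, hy, hyx⟩ := Set.mem_iUnion₂.1 (ht (subset_tsupport f hx))
    have hq : Quotient.mk r y = Quotient.mk r x := Quotient.sound hyx
    rw [Finset.sum_eq_single (Quotient.mk r x).out]
    · rw [if_pos (hout x), mul_one, hf _ _ (hout x)]
    · intro c hc hne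
      rw [if_neg, mul_zero]
      intro hr
      obtain ⟨z, _, rfl⟩ := Finset.mem_image.1 (Finset.mem_filter.1 hc).1
      apply hne
      rw [← Quotient.sound hr, Quotient.out_eq]
    · intro hn
      refine absurd (Finset.mem_filter.2 ⟨Finset.mem_image.2 ⟨y, hy, by rw [hq]⟩, ?_⟩) hn
      rwa [← hf _ _ (hout x)]

end FiniteDecomposition

/-! ### Coset functions and double coset operators. -/

section Cosets

variable {G : Type*} [Group G] [TopologicalSpace G]

theorem chFun_apply (K : LevelSubgroup G) [DecidablePred (· ∈ K.toSubgroup)] (g : G) :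
    chFun K g = if g ∈ K.toSubgroup then 1 else 0 := by
  by_cases h : g ∈ K.toSubgroup <;> simp [chFun, Set.indicator, h]

theorem chFun_of_notMem (K : LevelSubgroup G) {g : G} (h : g ∉ K.toSubgroup) : chFun K g = 0 :=
  Set.indicator_of_notMem (s := (K.toSubgroup : Set G)) h _

/-- The double coset `K c K`. -/
def dblCoset (K : LevelSubgroup G) (c : G) : Set G :=
  {g | ∃ k ∈ K.toSubgroup, ∃ k' ∈ K.toSubgroup, k * c * k' = g}

theorem mul_mem_dblCoset (K : LevelSubgroup G) (c : G) {k k' g : G} (hk : k ∈ K.toSubgroup)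
    (hk' : k' ∈ K.toSubgroup) : k * g * k' ∈ dblCoset K c ↔ g ∈ dblCoset K c := by
  constructor
  · rintro ⟨a, ha, b, hb, h⟩
    refine ⟨k⁻¹ * a, K.toSubgroup.mul_mem (K.toSubgroup.inv_mem hk) ha, b * k'⁻¹,
      K.toSubgroup.mul_mem hb (K.toSubgroup.inv_mem hk'), ?_⟩
    rw [← mul_assoc, mul_assoc k⁻¹, mul_assoc k⁻¹, h]
    simp [mul_assoc]
  · rintro ⟨a, ha, b, hb, rfl⟩
    exact ⟨k * a, K.toSubgroup.mul_mem hk ha, b * k', K.toSubgroup.mul_mem hb hk',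
      by simp [mul_assoc]⟩

variable [IsTopologicalGroup G]

/-- The characteristic function of the coset `g K`. -/
def chCoset (K : LevelSubgroup G) (g : G) : ↥(rightInvCc K) :=
  ⟨fun x => chFun K (g⁻¹ * x), ⟨(chFun_mem K).1.1.1.comp_continuous (continuous_const_mul _),
    (chFun_mem K).1.1.2.comp_homeomorph (Homeomorph.mulLeft g⁻¹)⟩,
    fun x k hk => by simp only [← mul_assoc, (chFun_mem K).1.2 _ k hk]⟩

theorem chCoset_one (K : LevelSubgroup G) : chCoset K 1 = chLevel K :=
  Subtype.ext <| funext fun x => by simp [chCoset, chLevel]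

theorem chCoset_mul_mem (K : LevelSubgroup G) (g : G) {k : G} (hk : k ∈ K.toSubgroup) :
    chCoset K (g * k) = chCoset K g :=
  Subtype.ext <| funext fun x => by
    simp only [chCoset, mul_inv_rev, mul_assoc]
    exact (chFun_mem K).2 _ _ (K.toSubgroup.inv_mem hk)

theorem leftRep_chCoset {H : Type*} [Group H] (ι : H →* G) (K : LevelSubgroup G) (γ : H) (g : G) :
    leftRep ι K γ (chCoset K g) = chCoset K (ι γ * g) :=
  Subtype.ext <| funext fun x => by simp [chCoset, leftRep, mul_assoc]

theorem exists_sum_chCoset (K : LevelSubgroup G) (ξ : ↥(rightInvCc K)) :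
    ∃ s : Finset G, (∀ g ∈ s, ξ.1 g ≠ 0) ∧ ξ = ∑ g ∈ s, ξ.1 g • chCoset K g := by
  classical
  obtain ⟨s, hs, h⟩ := exists_finset_sum_classes (QuotientGroup.leftRel K.toSubgroup) (f := ξ.1)
    (fun x => by
      simp only [QuotientGroup.leftRel_apply]
      exact K.isOpen'.preimage (continuous_const_mul x⁻¹))
    (fun x y hxy => by
      rw [QuotientGroup.leftRel_apply] at hxy
      simpa using ξ.2.2 x _ hxy) ξ.2.1.2
  refine ⟨s, hs, Subtype.ext <| funext fun x => ?_⟩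
  rw [h x]
  simp only [Submodule.coe_sum, Finset.sum_apply, Submodule.coe_smul, Pi.smul_apply, smul_eq_mul,
    QuotientGroup.leftRel_apply, chCoset, chFun_apply]

theorem mem_span_chCoset (K : LevelSubgroup G) (ξ : ↥(rightInvCc K)) :
    ξ ∈ Submodule.span ℂ (Set.range (chCoset K)) := by
  obtain ⟨s, -, h⟩ := exists_sum_chCoset K ξ
  rw [h]
  exact Submodule.sum_mem _ fun g _ => Submodule.smul_mem _ _ (Submodule.subset_span ⟨g, rfl⟩)

open scoped Pointwise in
/-- The characteristic function of `K c K`. -/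
def chDouble (K : LevelSubgroup G) (c : G) : HeckeAlg K :=
  ⟨Set.indicator (dblCoset K c) 1, by
    classical
    have hr : ∀ g, ∀ k ∈ K.toSubgroup,
        Set.indicator (dblCoset K c) (1 : G → ℂ) (g * k) =
          Set.indicator (dblCoset K c) (1 : G → ℂ) g := by
      intro g k hk
      have := mul_mem_dblCoset K c (g := g) K.toSubgroup.one_mem hk
      rw [one_mul] at this
      simp only [Set.indicator_apply, this, Pi.one_apply]
    refine ⟨⟨⟨isLocallyConstant_of_right_inv K hr, ?_⟩, hr⟩, fun g k hk => ?_⟩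
    · refine HasCompactSupport.intro ((K.isCompact'.mul isCompact_singleton).mul K.isCompact')
        (K := (K.toSubgroup : Set G) * {c} * (K.toSubgroup : Set G))
        fun x hx => Set.indicator_of_notMem ?_ _
      rintro ⟨a, ha, b, hb, rfl⟩
      exact hx ⟨a * c, ⟨a, ha, c, rfl, rfl⟩, b, hb, rfl⟩
    · have := mul_mem_dblCoset K c (g := g) hk K.toSubgroup.one_mem
      rw [mul_one] at this
      simp only [Set.indicator_apply, this, Pi.one_apply]⟩

open Classical in
theorem chDouble_apply (K : LevelSubgroup G) (c g : G) : (chDouble K c).1 g =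
    if ∃ k ∈ K.toSubgroup, ∃ k' ∈ K.toSubgroup, k * c * k' = g then 1 else 0 :=
  Set.indicator_apply _ _ _

variable [MeasurableSpace G] [BorelSpace G]

/-- A bi-invariant function `θ` sends `ch(g K)` to `x ↦ θ (x⁻¹ g)`. -/
theorem heckeAct_chCoset (K : LevelSubgroup G) (θ : HeckeAlg K) (g x : G) :
    (heckeAct K θ (chCoset K g)).1 x = θ.1 (x⁻¹ * g) := by
  change ∫ y, θ.1 y * chFun K (g⁻¹ * (x * y)) ∂K.haar = _
  -- After y ↦ x⁻¹gy the second factor is ch(K) at y, and right invariance makes θ(x⁻¹gy) constant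
  -- on K.
  rw [← integral_mul_left_eq_self _ (x⁻¹ * g),
    ← integral_ch_mul K (fun y => θ.1 (x⁻¹ * g * y)) _ fun k hk => θ.2.1.2 _ k hk]
  refine integral_congr_ae (Filter.Eventually.of_forall fun y => ?_)
  simp [mul_assoc, mul_comm]

end Cosets

/-! ### Working modulo a Hecke submodule. -/

section Generated

variable (p : ℕ) [Fact p.Prime] {G : Type*} [Group G] [TopologicalSpace G] [IsTopologicalGroup G]
  [MeasurableSpace G] [BorelSpace G] (ι : GL (Fin 2) ℚ_[p] →* G) (K : LevelSubgroup G)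

/-- The function c · ch(K) is c times the unit of the Hecke algebra. Hence a Hecke submodule is a
complex subspace, and linear algebra over ℂ applies to the quotient. -/
theorem exists_hecke_smul_eq (c : ℂ) :
    ∃ θ : HeckeAlg K, ∀ x : CoinvModule p ι K, θ • x = c • x := by
  refine ⟨⟨c • chFun K, Submodule.smul_mem _ _ (chFun_mem K)⟩, fun x => ?_⟩
  have h : heckeCoinv p ι K ⟨c • chFun K, Submodule.smul_mem _ _ (chFun_mem K)⟩ =
      c • LinearMap.id := by
    refine Representation.Coinvariants.hom_ext (TensorProduct.ext' fun φ ξ => ?_)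
    change coinvClass p ι K φ (heckeAct K ⟨c • chFun K, _⟩ ξ) = c • coinvClass p ι K φ ξ
    have : heckeAct K ⟨c • chFun K, Submodule.smul_mem _ _ (chFun_mem K)⟩ ξ = c • ξ := by
      refine Subtype.ext <| funext fun x => ?_
      change ∫ g, (c • chFun K) g * ξ.1 (x * g) ∂K.haar = c * ξ.1 x
      rw [← integral_ch_mul K (fun g => c * ξ.1 (x * g)) _
        fun k hk => congrArg (c * ·) (ξ.2.2 x k hk)]
      refine integral_congr_ae (Filter.Eventually.of_forall fun y => ?_)
      simp [mul_assoc, mul_left_comm]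
    rw [this]
    rw [coinvClass, TensorProduct.tmul_smul]
    exact map_smul _ _ _
  exact congrArg (fun f => f x) h

/-- A Hecke submodule of the coinvariants, as a complex vector space. -/
def complexSubmodule (N : Submodule (HeckeAlg K) (CoinvModule p ι K)) :
    Submodule ℂ (CoinvModule p ι K) where
  carrier := N
  zero_mem' := N.zero_mem
  add_mem' := N.add_mem
  smul_mem' c x hx := by
    obtain ⟨θ, hθ⟩ := exists_hecke_smul_eq p ι K c
    exact hθ x ▸ N.smul_mem θ hx

variable {p ι K}
variable (N : Submodule (HeckeAlg K) (CoinvModule p ι K))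

/-- `φ ⊗ ξ ↦ [φ ⊗ ξ]` modulo a Hecke submodule. -/
def classMod : ↥(smoothCc (Fin 2 → ℚ_[p])) →ₗ[ℂ] ↥(rightInvCc K) →ₗ[ℂ]
    (CoinvModule p ι K ⧸ complexSubmodule p ι K N) :=
  (TensorProduct.mk ℂ _ _).compr₂
    ((complexSubmodule p ι K N).mkQ ∘ₗ Representation.Coinvariants.mk (tensorRep p ι K))

theorem classMod_eq_zero {φ : ↥(smoothCc (Fin 2 → ℚ_[p]))} {ξ : ↥(rightInvCc K)} :
    classMod N φ ξ = 0 ↔ coinvClass p ι K φ ξ ∈ N :=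
  Submodule.Quotient.mk_eq_zero _

theorem classMod_rep (γ : GL (Fin 2) ℚ_[p]) (φ : ↥(smoothCc (Fin 2 → ℚ_[p])))
    (ξ : ↥(rightInvCc K)) :
    classMod N (schwartzRep p γ φ) (leftRep ι K γ ξ) = classMod N φ ξ :=
  congrArg (complexSubmodule p ι K N).mkQ
    (Representation.Coinvariants.mk_self_apply (tensorRep p ι K) γ (φ ⊗ₜ[ℂ] ξ))

theorem classMod_heckeAct {φ : ↥(smoothCc (Fin 2 → ℚ_[p]))} {ξ : ↥(rightInvCc K)}
    (h : classMod N φ ξ = 0) (θ : HeckeAlg K) : classMod N φ (heckeAct K θ ξ) = 0 := by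
  rw [classMod_eq_zero] at h ⊢
  exact N.smul_mem θ h

/-- The coinvariance relation trades a translation of the coset by γ for a translation of φ by γ⁻¹.
-/
theorem classMod_chCoset_left (γ : GL (Fin 2) ℚ_[p]) (φ : ↥(smoothCc (Fin 2 → ℚ_[p]))) (g : G) :
    classMod N φ (chCoset K (ι γ * g)) = classMod N (schwartzRep p γ⁻¹ φ) (chCoset K g) := by
  rw [← classMod_rep N γ⁻¹ φ, leftRep_chCoset]
  simp

/-- All classes `[φ ⊗ ch(g K)]` lie in `N`. -/
def Good (g : G) : Prop := ∀ φ, classMod N φ (chCoset K g) = 0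

variable {N}

theorem good_left (γ : GL (Fin 2) ℚ_[p]) {g : G} (h : Good N g) : Good N (ι γ * g) := fun φ => by
  rw [classMod_chCoset_left, h]

theorem good_right {g k : G} (h : Good N g) (hk : k ∈ K.toSubgroup) : Good N (g * k) := fun φ => by
  rw [chCoset_mul_mem K g hk, h]

theorem eq_top_of_forall_good (h : ∀ g, Good N g) : N = ⊤ := by
  rw [eq_top_iff]
  rintro x -
  induction x using Representation.Coinvariants.induction_on with
  | _ v =>
    change Representation.Coinvariants.mk (tensorRep p ι K) v ∈ complexSubmodule p ι K N
    have hz : (complexSubmodule p ι K N).mkQ ∘ₗ Representation.Coinvariants.mk (tensorRep p ι K)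
        = 0 := by
      refine TensorProduct.ext' fun φ ξ => ?_
      change classMod N φ ξ = 0
      have : Submodule.span ℂ (Set.range (chCoset K)) ≤ LinearMap.ker (classMod N φ) := by
        rw [Submodule.span_le]
        rintro _ ⟨g, rfl⟩
        exact h g φ
      exact this (mem_span_chCoset K ξ)
    rw [← Submodule.Quotient.mk_eq_zero]
    exact LinearMap.congr_fun hz v

/-- Hecke operators supported on central elements. -/
theorem classMod_mul_central {φ : ↥(smoothCc (Fin 2 → ℚ_[p]))} {g z : G}
    (hz : ∀ x, z * x = x * z) (h : classMod N φ (chCoset K g) = 0) :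
    classMod N φ (chCoset K (g * z)) = 0 := by
  classical
  -- The inverse appears because θ sends ch(gK) to x ↦ θ(x⁻¹g): as z is central, x⁻¹g ∈ K z⁻¹ K
  -- means x ∈ g z K.
  have := classMod_heckeAct N h (chDouble K z⁻¹)
  have he : heckeAct K (chDouble K z⁻¹) (chCoset K g) = chCoset K (g * z) := by
    refine Subtype.ext <| funext fun x => ?_
    rw [heckeAct_chCoset, chDouble_apply]
    change _ = chFun K _
    rw [chFun_apply]
    have hz' : ∀ x, z⁻¹ * x = x * z⁻¹ := fun x => by
      rw [inv_mul_eq_iff_eq_mul, ← mul_assoc, hz, mul_assoc, mul_inv_cancel, mul_one]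
    refine if_congr ⟨?_, fun hm => ?_⟩ rfl rfl
    · rintro ⟨k, hk, k', hk', he⟩
      have : (g * z)⁻¹ * x = (k * k')⁻¹ := by
        rw [← inv_inj, inv_inv, mul_inv_rev, inv_inv, ← mul_assoc, ← he, mul_assoc k, hz' k',
          mul_assoc, mul_assoc, inv_mul_cancel, mul_one]
      rw [this]
      exact K.toSubgroup.inv_mem (K.toSubgroup.mul_mem hk hk')
    · refine ⟨((g * z)⁻¹ * x)⁻¹, K.toSubgroup.inv_mem hm, 1, K.toSubgroup.one_mem, ?_⟩
      simp [mul_assoc]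
  rwa [he] at this

/-- If `g c K` carries the value `v`, and every coset in `g K c K` carries `v` or `0`, then `v` is
`0` as soon as the class attached to `g` is. -/
theorem classMod_double_coset {φ : ↥(smoothCc (Fin 2 → ℚ_[p]))} {g c : G}
    (h : classMod N φ (chCoset K g) = 0)
    (hv : ∀ k ∈ K.toSubgroup, classMod N φ (chCoset K (g * (k * c))) = 0 ∨
      classMod N φ (chCoset K (g * (k * c))) = classMod N φ (chCoset K (g * c))) :
    classMod N φ (chCoset K (g * c)) = 0 := by
  classical
  by_contra hne
  -- Here x⁻¹g ∈ K c⁻¹ K means x ∈ g K c K, so ξ is the sum of the ch(xK) over the cosets in g K c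
  -- K, each with coefficient 1.
  have h0 := classMod_heckeAct N h (chDouble K c⁻¹)
  set ξ := heckeAct K (chDouble K c⁻¹) (chCoset K g) with hξ
  obtain ⟨s, hs, hsum⟩ := exists_sum_chCoset K ξ
  have hval : ∀ x, ξ.1 x ≠ 0 → ξ.1 x = 1 ∧ ∃ k ∈ K.toSubgroup,
      chCoset K x = chCoset K (g * (k * c)) := by
    intro x hx
    rw [hξ, heckeAct_chCoset, chDouble_apply] at hx ⊢
    split_ifs at hx ⊢ with hk
    · refine ⟨rfl, ?_⟩
      obtain ⟨k, hk, k', hk', he⟩ := hk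
      refine ⟨k'⁻¹, K.toSubgroup.inv_mem hk', ?_⟩
      have : x = g * (k'⁻¹ * c) * k⁻¹ := by
        rw [← inv_inj, ← mul_left_inj g, ← he]
        simp [mul_assoc]
      rw [this, chCoset_mul_mem K _ (K.toSubgroup.inv_mem hk)]
    · exact absurd rfl hx
  -- The coset g c K itself occurs, so the multiplicity of v in the sum is not 0.
  have hmem : ∃ x ∈ s, chCoset K x = chCoset K (g * c) := by
    have h1 : ξ.1 (g * c) = 1 := by
      rw [hξ, heckeAct_chCoset, chDouble_apply, if_pos]
      exact ⟨1, K.toSubgroup.one_mem, 1, K.toSubgroup.one_mem, by simp [mul_assoc]⟩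
    have h2 : (∑ x ∈ s, ξ.1 x • chCoset K x).1 (g * c) ≠ 0 := by
      rw [← hsum, h1]; exact one_ne_zero
    simp only [Submodule.coe_sum, Finset.sum_apply] at h2
    obtain ⟨x, hx, hx0⟩ := Finset.exists_ne_zero_of_sum_ne_zero h2
    refine ⟨x, hx, ?_⟩
    have hk : x⁻¹ * (g * c) ∈ K.toSubgroup := by
      by_contra hn
      apply hx0
      change ξ.1 x * chFun K (x⁻¹ * (g * c)) = 0
      rw [chFun_of_notMem K hn, mul_zero]
    rw [← chCoset_mul_mem K x hk, mul_inv_cancel_left]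
  set v := classMod N φ (chCoset K (g * c)) with hvdef
  have hsv : ∀ x ∈ s, classMod N φ (ξ.1 x • chCoset K x) =
      if classMod N φ (chCoset K x) = v then v else 0 := by
    intro x hx
    obtain ⟨h1, k, hk, he⟩ := hval x (hs x hx)
    rw [h1, one_smul]
    split_ifs with hif
    · exact hif
    · rw [he] at hif ⊢
      exact (hv k hk).resolve_right hif
  rw [hsum, map_sum, Finset.sum_congr rfl hsv, ← Finset.sum_filter, Finset.sum_const,
    ← Nat.cast_smul_eq_nsmul ℂ] at h0
  obtain ⟨x, hx, hxe⟩ := hmem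
  rcases smul_eq_zero.1 h0 with hcard | hv0
  · rw [Nat.cast_eq_zero, Finset.card_eq_zero] at hcard
    have : x ∈ s.filter fun x => classMod N φ (chCoset K x) = v :=
      Finset.mem_filter.2 ⟨hx, by rw [hxe]⟩
    rw [hcard] at this
    simp at this
  · exact hne hv0

end Generated

/-! ### Functionals on the Schwartz space and balls in ℚ_p². -/

section Schwartz

variable (p : ℕ) [Fact p.Prime]

/-- The characteristic function of the ball of centre `c` and radius `‖a‖` in `ℚ_p²`. -/
def chBall (a : ℚ_[p]ˣ) (c : Fin 2 → ℚ_[p]) : ↥(smoothCc (Fin 2 → ℚ_[p])) :=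
  ⟨Set.indicator (Metric.closedBall c ‖(a : ℚ_[p])‖) 1, by
    refine ⟨?_, HasCompactSupport.intro (isCompact_closedBall c ‖(a : ℚ_[p])‖)
      fun x hx => Set.indicator_of_notMem hx _⟩
    have hc := IsUltrametricDist.isClopen_closedBall c (norm_ne_zero_iff.2 a.ne_zero)
    exact (LocallyConstant.charFn ℂ hc).isLocallyConstant⟩

open Classical in
theorem chBall_apply (a : ℚ_[p]ˣ) (c v : Fin 2 → ℚ_[p]) :
    (chBall p a c).1 v = if ‖v - c‖ ≤ ‖(a : ℚ_[p])‖ then 1 else 0 := by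
  refine (Set.indicator_apply _ _ _).trans (if_congr ?_ rfl rfl)
  rw [Metric.mem_closedBall, dist_eq_norm]

open Classical in
theorem chZp_apply (v : Fin 2 → ℚ_[p]) : (chZp p).1 v = if ‖v‖ ≤ 1 then 1 else 0 := by
  refine (Set.indicator_apply _ _ _).trans (if_congr ?_ rfl rfl)
  rw [pi_norm_le_iff_of_nonneg zero_le_one]
  rfl

theorem schwartzRep_apply (γ : GL (Fin 2) ℚ_[p]) (φ : ↥(smoothCc (Fin 2 → ℚ_[p])))
    (v : Fin 2 → ℚ_[p]) :
    (schwartzRep p γ φ).1 v = φ.1 (Matrix.vecMul v (γ : Matrix (Fin 2) (Fin 2) ℚ_[p])) := rfl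

variable {p}

/-- A locally constant, compactly supported function is uniformly locally constant. -/
theorem exists_radius (φ : ↥(smoothCc (Fin 2 → ℚ_[p]))) :
    ∃ a : ℚ_[p]ˣ, ∀ v w, ‖w - v‖ ≤ ‖(a : ℚ_[p])‖ → φ.1 w = φ.1 v := by
  obtain ⟨δ, hδ, h⟩ := lebesgue_number_lemma_of_metric φ.2.2.isCompact
    (c := fun z : ℂ => φ.1 ⁻¹' {z}) (fun z => φ.2.1.isOpen_fiber z)
    (fun v _ => Set.mem_iUnion.2 ⟨φ.1 v, rfl⟩)
  obtain ⟨x, hx0, hx⟩ := NormedField.exists_norm_lt ℚ_[p] hδ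
  have key : ∀ v w, ‖w - v‖ ≤ ‖x‖ → φ.1 v ≠ 0 → φ.1 w = φ.1 v := by
    intro v w hvw hv
    obtain ⟨z, hz⟩ := h v (subset_tsupport _ hv)
    have h1 : φ.1 v = z := hz (Metric.mem_ball_self hδ)
    have h2 : φ.1 w = z := hz (by rw [Metric.mem_ball, dist_eq_norm]; exact hvw.trans_lt hx)
    rw [h1, h2]
  -- The Lebesgue number only controls points of the support; if φ vanishes at v, exchange the roles
  -- of v and w.
  refine ⟨Units.mk0 x (norm_pos_iff.1 hx0), fun v w hvw => ?_⟩
  by_cases hv : φ.1 v = 0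
  · by_contra hne
    rw [hv] at hne
    exact hne ((key w v (by rwa [norm_sub_rev]) hne).symm.trans hv)
  · exact key v w hvw hv

theorem exists_sum_chBall {a : ℚ_[p]ˣ} {φ : ↥(smoothCc (Fin 2 → ℚ_[p]))}
    (h : ∀ v w, ‖w - v‖ ≤ ‖(a : ℚ_[p])‖ → φ.1 w = φ.1 v) :
    ∃ s : Finset (Fin 2 → ℚ_[p]), (∀ c ∈ s, φ.1 c ≠ 0) ∧ φ = ∑ c ∈ s, φ.1 c • chBall p a c := by
  classical
  obtain ⟨s, hs, hsum⟩ := exists_finset_sum_classes (f := φ.1)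
    { r := fun v w => ‖w - v‖ ≤ ‖(a : ℚ_[p])‖
      iseqv := ⟨fun v => by simp, fun {v w} hvw => by rwa [norm_sub_rev], fun {u v w} h1 h2 => by
        have := IsUltrametricDist.norm_add_le_max (w - v) (v - u)
        rw [sub_add_sub_cancel] at this
        exact this.trans (max_le h2 h1)⟩ }
    (fun v => by
      have := (IsUltrametricDist.isClopen_closedBall v (norm_ne_zero_iff.2 a.ne_zero)).isOpen
      simpa [Metric.closedBall, dist_eq_norm] using this) h φ.2.2
  refine ⟨s, hs, Subtype.ext <| funext fun v => ?_⟩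
  rw [hsum v]
  simp only [Submodule.coe_sum, Finset.sum_apply, Submodule.coe_smul, Pi.smul_apply, smul_eq_mul,
    chBall_apply]

/-- Nonzero norms on ℚ_p are integral powers of p, so a strict drop is a drop by a factor of at
least p. -/
theorem padic_norm_le_of_lt {a b : ℚ_[p]} (h : ‖b‖ < ‖a‖) : ‖b‖ ≤ ‖(p : ℚ_[p]) * a‖ := by
  have ha : 0 < ‖a‖ := (norm_nonneg b).trans_lt h
  have h1 : ‖b / a‖ < (p : ℝ) ^ ((-1 : ℤ) + 1) := by
    simpa [norm_div, div_lt_one ha] using h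
  have h2 := (Padic.norm_le_pow_iff_norm_lt_pow_add_one (b / a) (-1)).2 h1
  rw [norm_div, div_le_iff₀ ha] at h2
  simpa [norm_mul] using h2

/-- A linear functional on `S(ℚ_p²)` vanishes if it kills balls around the origin and is invariant
under isometries that are transitive on vectors of given norm. -/
theorem functional_eq_zero {V : Type*} [AddCommGroup V] [Module ℂ V]
    (l : ↥(smoothCc (Fin 2 → ℚ_[p])) →ₗ[ℂ] V) (hball : ∀ a, l (chBall p a 0) = 0)
    (horb : ∀ v w : Fin 2 → ℚ_[p], ‖v‖ = ‖w‖ → ∃ γ : GL (Fin 2) ℚ_[p],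
      Matrix.vecMul v (γ : Matrix (Fin 2) (Fin 2) ℚ_[p]) = w ∧
      (∀ u, ‖Matrix.vecMul u (γ : Matrix (Fin 2) (Fin 2) ℚ_[p])‖ = ‖u‖) ∧
      ∀ φ, l (schwartzRep p γ φ) = l φ) : l = 0 := by
  classical
  have hcoset : ∀ (a : ℚ_[p]ˣ) (v w : Fin 2 → ℚ_[p]), ‖v‖ = ‖w‖ →
      l (chBall p a v) = l (chBall p a w) := by
    intro a v w hvw
    obtain ⟨γ, rfl, hiso, hl⟩ := horb v w hvw
    rw [← hl (chBall p a (Matrix.vecMul v _))]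
    congr 1
    refine Subtype.ext <| funext fun u => ?_
    rw [schwartzRep_apply, chBall_apply, chBall_apply, ← Matrix.sub_vecMul, hiso]
  have hzero : ∀ (a : ℚ_[p]ˣ) (c : Fin 2 → ℚ_[p]), l (chBall p a c) = 0 := by
    intro a c
    by_cases hc : ‖c‖ ≤ ‖(a : ℚ_[p])‖
    · rw [← hball a]
      congr 1
      refine Subtype.ext <| funext fun u => ?_
      rw [chBall_apply, chBall_apply, sub_zero]
      refine if_congr ⟨fun h => ?_, fun h => ?_⟩ rfl rfl
      · simpa using (IsUltrametricDist.norm_add_le_max (u - c) c).trans (max_le h hc)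
      · rw [sub_eq_add_neg]
        exact (IsUltrametricDist.norm_add_le_max u (-c)).trans (max_le h (by rwa [norm_neg]))
    · rw [not_le] at hc
      obtain ⟨i, hi⟩ : ∃ i, ‖c i‖ = ‖c‖ := by
        obtain ⟨i, -, hi⟩ := Finset.exists_mem_eq_sup Finset.univ Finset.univ_nonempty
          fun i => ‖c i‖₊
        exact ⟨i, by rw [Pi.norm_def, hi]; rfl⟩
      have hci : c i ≠ 0 := by
        rw [← norm_ne_zero_iff, hi]
        exact ((norm_nonneg _).trans_lt hc).ne'
      -- The ball misses the origin. With b of norm ‖c‖ and b' of the next smaller norm, the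
      -- difference of the two balls around 0 is the indicator of the sphere of radius ‖c‖, which l
      -- kills.
      have hp0 : (p : ℚ_[p]) ≠ 0 := Nat.cast_ne_zero.2 (Fact.out : p.Prime).ne_zero
      set b : ℚ_[p]ˣ := Units.mk0 (c i) hci with hb
      set b' : ℚ_[p]ˣ := Units.mk0 ((p : ℚ_[p]) * c i) (mul_ne_zero hp0 hci) with hb'
      have hbn : ‖(b : ℚ_[p])‖ = ‖c‖ := hi
      have hlt : ‖(b' : ℚ_[p])‖ < ‖c‖ := by
        have hpn : ‖(p : ℚ_[p])‖ < 1 := Padic.norm_p_lt_one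
        rw [hb', Units.val_mk0, norm_mul, hi]
        exact mul_lt_of_lt_one_left ((norm_nonneg _).trans_lt hc) hpn
      have hval : ∀ v, (chBall p b 0 - chBall p b' 0).1 v = if ‖v‖ = ‖c‖ then 1 else 0 := by
        intro v
        change (chBall p b 0).1 v - (chBall p b' 0).1 v = _
        rw [chBall_apply, chBall_apply, sub_zero, hbn]
        have hiff : ‖v‖ ≤ ‖(b' : ℚ_[p])‖ ↔ ‖v‖ < ‖c‖ := by
          refine ⟨fun h => h.trans_lt hlt, fun h => ?_⟩
          refine (pi_norm_le_iff_of_nonneg (norm_nonneg _)).2 fun j => ?_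
          refine padic_norm_le_of_lt ?_
          rw [hi]
          exact (norm_le_pi_norm v j).trans_lt h
        rcases lt_trichotomy ‖v‖ ‖c‖ with h | h | h
        · rw [if_pos h.le, if_pos (hiff.2 h), if_neg h.ne, sub_self]
        · rw [if_pos h.le, if_neg (fun h' => (hiff.1 h').ne h), if_pos h, sub_zero]
        · rw [if_neg h.not_ge, if_neg (fun h' => (hiff.1 h').not_gt h), if_neg h.ne', sub_zero]
      -- Since ‖a‖ < ‖c‖, the sphere is a disjoint union of balls of radius ‖a‖. By `hcoset` they
      -- share one value of l, so a positive multiple of that value is 0.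
      obtain ⟨s, hs, hsum⟩ := exists_sum_chBall (a := a) (φ := chBall p b 0 - chBall p b' 0)
        (fun v w hvw => by
          rw [hval, hval]
          refine if_congr ?_ rfl rfl
          have hsw : ∀ v w : Fin 2 → ℚ_[p], ‖w - v‖ ≤ ‖(a : ℚ_[p])‖ → ‖w‖ = ‖c‖ →
              ‖v‖ = ‖c‖ := by
            intro v w hvw hw
            have hne : ‖w‖ ≠ ‖v - w‖ := by
              rw [hw, norm_sub_rev]; exact (hvw.trans_lt hc).ne'
            have := IsUltrametricDist.norm_add_eq_max_of_norm_ne_norm hne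
            rw [add_sub_cancel, hw, norm_sub_rev, max_eq_left (hvw.trans hc.le)] at this
            exact this
          exact ⟨hsw v w hvw, hsw w v (by rwa [norm_sub_rev])⟩)
      have hterm : ∀ x ∈ s, (chBall p b 0 - chBall p b' 0).1 x • l (chBall p a x) =
          l (chBall p a c) := by
        intro x hx
        have hx0 := hs x hx
        rw [hval] at hx0 ⊢
        split_ifs at hx0 ⊢ with hxc
        · rw [one_smul, hcoset a x c hxc]
        · exact absurd rfl hx0
      have h0 : l (chBall p b 0 - chBall p b' 0) = 0 := by rw [map_sub, hball, hball, sub_zero]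
      have hne : s.Nonempty := by
        rw [Finset.nonempty_iff_ne_empty]
        rintro rfl
        have := hval c
        rw [hsum, if_pos rfl] at this
        exact zero_ne_one this
      rw [hsum, map_sum] at h0
      simp only [map_smul] at h0
      rw [Finset.sum_congr rfl hterm, Finset.sum_const, ← Nat.cast_smul_eq_nsmul ℂ] at h0
      exact (smul_eq_zero.1 h0).resolve_left (Nat.cast_ne_zero.2 hne.card_pos.ne')
  refine LinearMap.ext fun φ => ?_
  obtain ⟨a, ha⟩ := exists_radius φ
  obtain ⟨s, -, hsum⟩ := exists_sum_chBall ha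
  rw [hsum, map_sum, LinearMap.zero_apply]
  exact Finset.sum_eq_zero fun c _ => by rw [map_smul, hzero, smul_zero]

end Schwartz

/-! ### Norms and orthonormal bases in the unramified extension. -/

section Unramified

variable {p : ℕ} [Fact p.Prime] {F : Type*} [NormedField F] [NormedAlgebra ℚ_[p] F]

theorem norm_algebraMap_padic (a : ℚ_[p]) : ‖algebraMap ℚ_[p] F a‖ = ‖a‖ := norm_algebraMap' F a

/-- If x were not in the maximal ideal (p), it would be invertible modulo p, giving 1 = yx + pc with
both terms of norm below 1. -/
theorem norm_le_of_lt_one (hunr : IsUnramified p F) {x : F} (hx : ‖x‖ < 1) :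
    ‖x‖ ≤ ‖(p : ℚ_[p])‖ := by
  have hu := IsUltrametricDist.of_normedAlgebra ℚ_[p] (L := F)
  have hpn : ‖(p : F)‖ = ‖(p : ℚ_[p])‖ := by
    rw [← norm_algebraMap_padic (F := F), map_natCast]
  have hp1 : ‖(p : F)‖ < 1 := hpn ▸ Padic.norm_p_lt_one
  by_cases hmem : (⟨x, hx.le⟩ : integers p F) ∈ Ideal.span {(p : integers p F)}
  · obtain ⟨c, hc⟩ := Ideal.mem_span_singleton.1 hmem
    have hxc : x = p * c.1 := by simpa using congrArg Subtype.val hc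
    rw [hxc, norm_mul, hpn]
    exact mul_le_of_le_one_right (norm_nonneg _) c.2
  · obtain ⟨y, i, hi, hy⟩ := Ideal.IsMaximal.exists_inv hunr hmem
    obtain ⟨c, rfl⟩ := Ideal.mem_span_singleton.1 hi
    have hyx : y.1 * x + p * c.1 = 1 := by simpa using congrArg Subtype.val hy
    have h1 : ‖y.1 * x‖ < 1 := by
      rw [norm_mul]
      exact (mul_le_of_le_one_left (norm_nonneg _) y.2).trans_lt hx
    have h2 : ‖(p : F) * c.1‖ < 1 := by
      rw [norm_mul]
      exact (mul_le_of_le_one_right (norm_nonneg _) c.2).trans_lt hp1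
    have := (IsUltrametricDist.norm_add_le_max (y.1 * x) (p * c.1)).trans_lt (max_lt h1 h2)
    rw [hyx, norm_one] at this
    exact absurd this (lt_irrefl _)

/-- In an unramified extension every norm is the norm of an element of `ℚ_p`. -/
theorem exists_padic_norm_eq (hunr : IsUnramified p F) {x : F} (hx : x ≠ 0) :
    ∃ a : ℚ_[p]ˣ, ‖(a : ℚ_[p])‖ = ‖x‖ := by
  have hp1 : (1 : ℝ) < p := Nat.one_lt_cast.2 (Fact.out : p.Prime).one_lt
  have hp0 : (p : ℚ_[p]) ≠ 0 := Nat.cast_ne_zero.2 (Fact.out : p.Prime).ne_zero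
  -- Scaling by a power of p puts the norm of x in (1/p, 1]; by the gap in `norm_le_of_lt_one` it
  -- must be 1.
  obtain ⟨n, hn1, hn2⟩ := exists_mem_Ioc_zpow (norm_pos_iff.2 hx) hp1
  have ha : ‖((p : ℚ_[p]) ^ (-(n + 1)))‖ = (p : ℝ) ^ (n + 1) := by
    rw [norm_zpow, Padic.norm_p, inv_zpow', neg_neg]
  refine ⟨Units.mk0 ((p : ℚ_[p]) ^ (-(n + 1))) (zpow_ne_zero _ hp0), ?_⟩
  rw [Units.val_mk0, ha]
  refine le_antisymm ?_ hn2
  by_contra hlt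
  rw [not_le] at hlt
  have hpos : (0 : ℝ) < (p : ℝ) ^ (n + 1) := zpow_pos (by linarith) _
  have hy : ‖x / algebraMap ℚ_[p] F ((p : ℚ_[p]) ^ (-(n + 1)))‖ = ‖x‖ / (p : ℝ) ^ (n + 1) := by
    rw [norm_div, norm_algebraMap_padic, ha]
  have := norm_le_of_lt_one hunr (x := x / algebraMap ℚ_[p] F ((p : ℚ_[p]) ^ (-(n + 1))))
    (by rw [hy]; exact (div_lt_one hpos).2 hlt)
  rw [hy, Padic.norm_p, div_le_iff₀ hpos, zpow_add_one₀ (by linarith), mul_comm,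
    mul_assoc, mul_inv_cancel₀ (by linarith), mul_one] at this
  exact absurd hn1 this.not_gt

/-- `τ` and `1` form an orthonormal basis of `F` over `ℚ_p`, and `F` has the same norms as
`ℚ_p`. -/
structure IsOrthoGen (p : ℕ) [Fact p.Prime] {F : Type*} [NormedField F] [NormedAlgebra ℚ_[p] F]
    (τ : F) : Prop where
  norm_eq : ∀ a b : ℚ_[p], ‖algebraMap ℚ_[p] F a * τ + algebraMap ℚ_[p] F b‖ = max ‖a‖ ‖b‖
  span : ∀ x : F, ∃ a b : ℚ_[p], x = algebraMap ℚ_[p] F a * τ + algebraMap ℚ_[p] F b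
  val : ∀ x : Fˣ, ∃ a : ℚ_[p]ˣ, ‖(a : ℚ_[p])‖ = ‖(x : F)‖

theorem exists_isOrthoGen [FiniteDimensional ℚ_[p] F] (hdeg : Module.finrank ℚ_[p] F = 2)
    (hunr : IsUnramified p F) : ∃ τ : F, IsOrthoGen p τ := by
  have hu := IsUltrametricDist.of_normedAlgebra ℚ_[p] (L := F)
  have : ProperSpace F := FiniteDimensional.proper ℚ_[p] F
  set S : Submodule ℚ_[p] F := LinearMap.range (Algebra.linearMap ℚ_[p] F) with hS
  obtain ⟨y, hy⟩ : ∃ y, y ∉ S := by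
    by_contra! hall
    have htop : S = ⊤ := Submodule.eq_top_iff'.2 hall
    have := LinearMap.finrank_range_le (Algebra.linearMap ℚ_[p] F)
    rw [← hS, htop, finrank_top, hdeg, Module.finrank_self] at this
    omega
  -- With z a best approximation to y in ℚ_p, y - z is orthogonal to ℚ_p in the ultrametric sense;
  -- dividing by b of equal norm gives the unit vector τ.
  obtain ⟨z, hz, hdist⟩ := (Submodule.closed_of_finiteDimensional S).exists_infDist_eq_dist
    ⟨0, S.zero_mem⟩ y
  have hyz : y - z ≠ 0 := fun h => hy (sub_eq_zero.1 h ▸ hz)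
  obtain ⟨b, hb⟩ := exists_padic_norm_eq hunr hyz
  have hb0 : (0 : ℝ) < ‖(b : ℚ_[p])‖ := norm_pos_iff.2 b.ne_zero
  have hbF : algebraMap ℚ_[p] F b ≠ 0 := by simp
  set τ : F := (y - z) / algebraMap ℚ_[p] F b with hτ
  have hτ1 : ‖τ‖ = 1 := by
    rw [hτ, norm_div, norm_algebraMap_padic, hb, div_self (norm_ne_zero_iff.2 hyz)]
  have hτge : ∀ c : ℚ_[p], 1 ≤ ‖τ + algebraMap ℚ_[p] F c‖ := by
    intro c
    have h1 : τ + algebraMap ℚ_[p] F c =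
        (y - (z - algebraMap ℚ_[p] F (b * c))) / algebraMap ℚ_[p] F b := by
      rw [hτ, map_mul]; field_simp; ring
    have h2 : z - algebraMap ℚ_[p] F (b * c) ∈ S := S.sub_mem hz ⟨_, rfl⟩
    have h3 := Metric.infDist_le_dist_of_mem (x := y) h2
    rw [hdist, dist_eq_norm, dist_eq_norm, ← hb] at h3
    rw [h1, norm_div, norm_algebraMap_padic, le_div_iff₀ hb0, one_mul]
    exact h3
  have hnorm : ∀ a b : ℚ_[p],
      ‖algebraMap ℚ_[p] F a * τ + algebraMap ℚ_[p] F b‖ = max ‖a‖ ‖b‖ := by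
    intro a c
    have ha : ‖algebraMap ℚ_[p] F a * τ‖ = ‖a‖ := by
      rw [norm_mul, hτ1, mul_one, norm_algebraMap_padic]
    rcases eq_or_ne ‖a‖ ‖c‖ with hac | hac
    · rw [← hac, max_self]
      rcases eq_or_ne a 0 with rfl | ha0
      · have hc0 : c = 0 := by simpa using hac.symm
        simp [hc0]
      · apply le_antisymm
        · refine (IsUltrametricDist.norm_add_le_max _ _).trans (max_le ha.le ?_)
          rw [norm_algebraMap_padic, hac]
        · have h1 : algebraMap ℚ_[p] F a * τ + algebraMap ℚ_[p] F c =
              algebraMap ℚ_[p] F a * (τ + algebraMap ℚ_[p] F (c / a)) := by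
            rw [mul_add, ← map_mul, mul_div_cancel₀ _ ha0]
          rw [h1, norm_mul, norm_algebraMap_padic]
          exact le_mul_of_one_le_right (norm_nonneg _) (hτge _)
    · rw [IsUltrametricDist.norm_add_eq_max_of_norm_ne_norm, ha, norm_algebraMap_padic]
      rwa [ha, norm_algebraMap_padic]
  refine ⟨τ, hnorm, fun x => ?_, fun x => exists_padic_norm_eq hunr x.ne_zero⟩
  let ψ : (Fin 2 → ℚ_[p]) →ₗ[ℚ_[p]] F :=
    { toFun := fun v => algebraMap ℚ_[p] F (v 0) * τ + algebraMap ℚ_[p] F (v 1)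
      map_add' := fun v w => by simp only [Pi.add_apply, map_add]; ring
      map_smul' := fun c v => by
        simp only [Pi.smul_apply, smul_eq_mul, map_mul, RingHom.id_apply, Algebra.smul_def]; ring }
  have hinj : Function.Injective ψ := by
    rw [injective_iff_map_eq_zero]
    intro v hv
    have h1 : max ‖v 0‖ ‖v 1‖ = 0 := by
      rw [← hnorm]; exact norm_eq_zero.2 hv
    have h2 : ∀ i, ‖v i‖ ≤ 0 := by
      intro i
      fin_cases i
      · exact h1 ▸ le_max_left _ _
      · exact h1 ▸ le_max_right _ _
    funext i
    exact norm_le_zero_iff.1 (h2 i)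
  obtain ⟨v, hv⟩ := (LinearMap.injective_iff_surjective_of_finrank_eq_finrank
    (by simp [hdeg])).1 hinj x
  exact ⟨v 0, v 1, hv.symm⟩

end Unramified

/-! ### Upper triangular matrices. -/

section Triangular

variable {k : Type*} [Field k]

/-- The matrix with rows `(a, x)` and `(0, d)`. -/
def triang (a d : kˣ) (x : k) : GL (Fin 2) k where
  val := !![(a : k), x; 0, (d : k)]
  inv := !![(a : k)⁻¹, -((a : k)⁻¹ * x * (d : k)⁻¹); 0, (d : k)⁻¹]
  val_inv := by
    rw [Matrix.mul_fin_two, Matrix.one_fin_two]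
    simp [mul_assoc]
  inv_val := by
    rw [Matrix.mul_fin_two, Matrix.one_fin_two]
    simp [mul_assoc]

theorem coe_triang (a d : kˣ) (x : k) :
    (triang a d x : Matrix (Fin 2) (Fin 2) k) = !![(a : k), x; 0, (d : k)] := rfl

theorem coe_triang_inv (a d : kˣ) (x : k) :
    (((triang a d x)⁻¹ : GL (Fin 2) k) : Matrix (Fin 2) (Fin 2) k) =
      !![(a : k)⁻¹, -((a : k)⁻¹ * x * (d : k)⁻¹); 0, (d : k)⁻¹] := rfl

theorem triang_mul (a d a' d' : kˣ) (x x' : k) :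
    triang a d x * triang a' d' x' = triang (a * a') (d * d') (a * x' + x * d') := by
  refine Units.ext ?_
  rw [Units.val_mul, coe_triang, coe_triang, Matrix.mul_fin_two, coe_triang]
  simp

/-- Splitting off a scalar normalises the lower right entry to 1. -/
theorem triang_eq_mul_scalar (a d : kˣ) (x : k) :
    triang a d x = triang (a * d⁻¹) 1 (x * (d : k)⁻¹) * triang d d 0 := by
  rw [triang_mul, inv_mul_cancel_right, one_mul, mul_zero, zero_add,
    inv_mul_cancel_right₀ d.ne_zero]

theorem triang_one : triang (1 : kˣ) 1 0 = 1 :=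
  Units.ext <| by rw [coe_triang, Units.val_one, Units.val_one, Matrix.one_fin_two]

theorem triang_scalar_comm (c : kˣ) (g : GL (Fin 2) k) :
    triang c c 0 * g = g * triang c c 0 := by
  refine Units.ext ?_
  rw [Units.val_mul, Units.val_mul, coe_triang, Matrix.eta_fin_two (g : Matrix (Fin 2) (Fin 2) k),
    Matrix.mul_fin_two, Matrix.mul_fin_two]
  simp [mul_comm]

theorem map_triang {k' : Type*} [Field k'] (f : k →+* k') (a d : kˣ) (x : k) :
    Matrix.GeneralLinearGroup.map f (triang a d x) =
      triang (Units.map (f : k →* k') a) (Units.map (f : k →* k') d) (f x) := by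
  refine Units.ext ?_
  ext i j
  fin_cases i <;> fin_cases j <;> simp [coe_triang]

end Triangular

/-! ### Iwasawa decomposition and the action of units of O_F on ℚ_p². -/

section Level

variable {p : ℕ} [Fact p.Prime] {F : Type*} [NormedField F] [NormedAlgebra ℚ_[p] F]

theorem triang_mem_GLInt {a d : Fˣ} {x : F} (ha : ‖(a : F)‖ = 1) (hd : ‖(d : F)‖ = 1)
    (hx : ‖x‖ ≤ 1) : triang a d x ∈ GLInt p F := by
  rw [mem_GLInt_iff, coe_triang, coe_triang_inv]
  constructor
  · intro i j
    fin_cases i <;> fin_cases j <;> simp [ha, hd, hx]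
  · intro i j
    fin_cases i <;> fin_cases j <;> simp [ha, hd, hx]

theorem norm_det_of_mem_GLInt {g : GL (Fin 2) F} (hg : g ∈ GLInt p F) :
    ‖(g : Matrix (Fin 2) (Fin 2) F).det‖ = 1 := by
  have hu := IsUltrametricDist.of_normedAlgebra ℚ_[p] (L := F)
  have key : ∀ M : Matrix (Fin 2) (Fin 2) F, (∀ i j, ‖M i j‖ ≤ 1) → ‖M.det‖ ≤ 1 := by
    intro M hM
    rw [Matrix.det_fin_two, sub_eq_add_neg]
    refine (IsUltrametricDist.norm_add_le_max _ _).trans (max_le ?_ ?_)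
    · rw [norm_mul]; exact mul_le_one₀ (hM _ _) (norm_nonneg _) (hM _ _)
    · rw [norm_neg, norm_mul]; exact mul_le_one₀ (hM _ _) (norm_nonneg _) (hM _ _)
  obtain ⟨h1, h2⟩ := (mem_GLInt_iff p g).1 hg
  have h3 := key _ h1
  have h4 := key _ h2
  have h5 : ‖(g : Matrix (Fin 2) (Fin 2) F).det‖ *
      ‖((g⁻¹ : GL (Fin 2) F) : Matrix (Fin 2) (Fin 2) F).det‖ = 1 := by
    rw [← norm_mul, ← Matrix.det_mul, ← Units.val_mul, mul_inv_cancel, Units.val_one,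
      Matrix.det_one, norm_one]
  refine le_antisymm h3 ?_
  rw [← h5]
  exact mul_le_of_le_one_right (norm_nonneg _) h4

/-- Iwasawa decomposition. -/
theorem exists_triang_mul (g : GL (Fin 2) F) :
    ∃ (a d : Fˣ) (x : F), ∃ k ∈ GLInt p F, g = triang a d x * k := by
  -- When the lower right entry dominates its row, an integral lower unipotent matrix clears the
  -- lower left entry; otherwise the columns are swapped first.
  have key : ∀ g : GL (Fin 2) F, ‖g.1 1 0‖ ≤ ‖g.1 1 1‖ →
      ∃ (a d : Fˣ) (x : F), ∃ k ∈ GLInt p F, g = triang a d x * k := by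
    intro g hle
    have hdet : g.1 0 0 * g.1 1 1 - g.1 0 1 * g.1 1 0 ≠ 0 := by
      rw [← Matrix.det_fin_two]
      exact ((Matrix.isUnit_iff_isUnit_det _).1 g.isUnit).ne_zero
    have hd : g.1 1 1 ≠ 0 := by
      intro h0
      rw [h0, norm_zero, norm_le_zero_iff] at hle
      simp [h0, hle] at hdet
    have ha : g.1 0 0 - g.1 0 1 * (g.1 1 0 / g.1 1 1) ≠ 0 := by
      intro h0
      apply hdet
      field_simp at h0
      simpa using h0
    let l : GL (Fin 2) F :=
      ⟨!![1, 0; g.1 1 0 / g.1 1 1, 1], !![1, 0; -(g.1 1 0 / g.1 1 1), 1],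
        by rw [Matrix.mul_fin_two, Matrix.one_fin_two]; simp,
        by rw [Matrix.mul_fin_two, Matrix.one_fin_two]; simp⟩
    have hc : ‖g.1 1 0 / g.1 1 1‖ ≤ 1 := by
      rw [norm_div]; exact div_le_one_of_le₀ hle (norm_nonneg _)
    refine ⟨Units.mk0 _ ha, Units.mk0 _ hd, g.1 0 1, l, ?_, ?_⟩
    · rw [mem_GLInt_iff]
      change (∀ i j, ‖!![1, 0; g.1 1 0 / g.1 1 1, 1] i j‖ ≤ 1) ∧
        ∀ i j, ‖!![1, 0; -(g.1 1 0 / g.1 1 1), 1] i j‖ ≤ 1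
      constructor <;> intro i j <;> fin_cases i <;> fin_cases j <;> simp <;> simpa using hc
    · refine Units.ext ?_
      rw [Units.val_mul, coe_triang]
      change _ = _ * !![1, 0; g.1 1 0 / g.1 1 1, 1]
      rw [Matrix.mul_fin_two]
      conv_lhs => rw [Matrix.eta_fin_two g.1]
      simp [mul_div_cancel₀ _ hd]
  rcases le_total ‖g.1 1 0‖ ‖g.1 1 1‖ with hle | hle
  · exact key g hle
  · let w : GL (Fin 2) F :=
      ⟨!![0, 1; 1, 0], !![0, 1; 1, 0], by rw [Matrix.mul_fin_two, Matrix.one_fin_two]; simp,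
        by rw [Matrix.mul_fin_two, Matrix.one_fin_two]; simp⟩
    have hw : w ∈ GLInt p F := by
      rw [mem_GLInt_iff]
      change (∀ i j, ‖!![(0 : F), 1; 1, 0] i j‖ ≤ 1) ∧ ∀ i j, ‖!![(0 : F), 1; 1, 0] i j‖ ≤ 1
      constructor <;> intro i j <;> fin_cases i <;> fin_cases j <;> simp
    have hgw : (g * w).1 = !![g.1 0 1, g.1 0 0; g.1 1 1, g.1 1 0] := by
      rw [Units.val_mul, Matrix.eta_fin_two g.1]
      change _ * !![(0 : F), 1; 1, 0] = _
      rw [Matrix.mul_fin_two]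
      simp
    obtain ⟨a, d, x, k, hk, h⟩ := key (g * w) (by rw [hgw]; simpa using hle)
    refine ⟨a, d, x, k * w⁻¹, mul_mem hk (inv_mem hw), ?_⟩
    rw [← mul_assoc, ← h, mul_inv_cancel_right]

/-- The identification of `ℚ_p²` with `F` in the basis `τ, 1`. -/
def evalVec (τ : F) (v : Fin 2 → ℚ_[p]) : F :=
  algebraMap ℚ_[p] F (v 0) * τ + algebraMap ℚ_[p] F (v 1)

theorem evalVec_sub (τ : F) (v w : Fin 2 → ℚ_[p]) :
    evalVec τ (v - w) = evalVec τ v - evalVec τ w := by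
  simp only [evalVec, Pi.sub_apply, map_sub]; ring

/-- `M` acts on `ℚ_p²` as multiplication by `α` in the basis `τ, 1`. -/
def IsMulMatrix (τ α : F) (M : Matrix (Fin 2) (Fin 2) ℚ_[p]) : Prop :=
  ∀ v, evalVec τ (Matrix.vecMul v M) = α * evalVec τ v

theorem IsMulMatrix.mul {τ α β : F} {M N : Matrix (Fin 2) (Fin 2) ℚ_[p]}
    (hM : IsMulMatrix τ α M) (hN : IsMulMatrix τ β N) : IsMulMatrix τ (β * α) (M * N) := fun v => by
  rw [← Matrix.vecMul_vecMul, hN, hM, mul_assoc]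

theorem IsMulMatrix.row_zero {τ α : F} {M : Matrix (Fin 2) (Fin 2) ℚ_[p]}
    (hM : IsMulMatrix τ α M) :
    algebraMap ℚ_[p] F (M 0 0) * τ + algebraMap ℚ_[p] F (M 0 1) = α * τ := by
  simpa [evalVec, Matrix.vecMul, dotProduct, Fin.sum_univ_two] using hM ![1, 0]

theorem IsMulMatrix.row_one {τ α : F} {M : Matrix (Fin 2) (Fin 2) ℚ_[p]}
    (hM : IsMulMatrix τ α M) :
    algebraMap ℚ_[p] F (M 1 0) * τ + algebraMap ℚ_[p] F (M 1 1) = α := by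
  simpa [evalVec, Matrix.vecMul, dotProduct, Fin.sum_univ_two] using hM ![0, 1]

namespace IsOrthoGen

theorem norm_gen {τ : F} (hτ : IsOrthoGen p τ) : ‖τ‖ = 1 := by simpa using hτ.norm_eq 1 0

theorem norm_evalVec {τ : F} (hτ : IsOrthoGen p τ) (v : Fin 2 → ℚ_[p]) :
    ‖evalVec τ v‖ = ‖v‖ := by
  rw [evalVec, hτ.norm_eq]
  refine le_antisymm (max_le (norm_le_pi_norm v 0) (norm_le_pi_norm v 1)) ?_
  refine (pi_norm_le_iff_of_nonneg (le_max_of_le_left (norm_nonneg _))).2 fun i => ?_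
  fin_cases i
  · exact le_max_left _ _
  · exact le_max_right _ _

theorem evalVec_injective {τ : F} (hτ : IsOrthoGen p τ) :
    Function.Injective (evalVec (p := p) τ) := fun v w h => by
  rw [← sub_eq_zero, ← norm_eq_zero, ← hτ.norm_evalVec, evalVec_sub, h, sub_self, norm_zero]

/-- The rows of the matrix are the coordinates of ατ and α in the basis τ, 1. -/
theorem exists_isMulMatrix {τ : F} (hτ : IsOrthoGen p τ) (α : F) :
    ∃ M : Matrix (Fin 2) (Fin 2) ℚ_[p], IsMulMatrix τ α M := by
  obtain ⟨a, b, h1⟩ := hτ.span (α * τ)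
  obtain ⟨c, d, h2⟩ := hτ.span α
  refine ⟨!![a, b; c, d], fun v => ?_⟩
  simp only [evalVec, Matrix.vecMul, dotProduct, Fin.sum_univ_two, Matrix.of_apply,
    Matrix.cons_val', Matrix.cons_val_zero, Matrix.cons_val_one, Matrix.cons_val_fin_one, map_add,
    map_mul]
  linear_combination (-(algebraMap ℚ_[p] F (v 0))) * h1 - (algebraMap ℚ_[p] F (v 1)) * h2

theorem eq_one_of_isMulMatrix {τ : F} (hτ : IsOrthoGen p τ) {M : Matrix (Fin 2) (Fin 2) ℚ_[p]}
    (hM : IsMulMatrix τ 1 M) : M = 1 :=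
  Matrix.ext_of_single_vecMul fun i => hτ.evalVec_injective <| by
    rw [hM, one_mul, Matrix.vecMul_one]

theorem exists_isMulMatrix_unit {τ : F} (hτ : IsOrthoGen p τ) {α : F} (hα : α ≠ 0) :
    ∃ γ : GL (Fin 2) ℚ_[p], IsMulMatrix τ α γ.1 ∧ IsMulMatrix τ α⁻¹ (γ⁻¹).1 := by
  obtain ⟨M, hM⟩ := hτ.exists_isMulMatrix α
  obtain ⟨N, hN⟩ := hτ.exists_isMulMatrix α⁻¹
  have h1 := hM.mul hN
  have h2 := hN.mul hM
  rw [inv_mul_cancel₀ hα] at h1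
  rw [mul_inv_cancel₀ hα] at h2
  exact ⟨⟨M, N, hτ.eq_one_of_isMulMatrix h1, hτ.eq_one_of_isMulMatrix h2⟩, hM, hN⟩

/-- If `A` is larger than `p ^ (n + 1)` then it is at least `p ^ n`. -/
theorem le_norm_of_lt {τ : F} (hτ : IsOrthoGen p τ) {n : ℕ} {A : Fˣ}
    (hA : ‖(p : ℚ_[p]) ^ (n + 1)‖ < ‖(A : F)‖) : ‖(p : ℚ_[p]) ^ n‖ ≤ ‖(A : F)‖ := by
  obtain ⟨a, ha⟩ := hτ.val A
  rw [← ha] at hA ⊢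
  by_contra hlt
  rw [not_le] at hlt
  have := padic_norm_le_of_lt hlt
  rw [← pow_succ'] at this
  exact absurd hA this.not_gt

/-- Units of `O_F`, acting on `ℚ_p²`, stabilise the lattice attached to `(A, τ; 0, 1)`. -/
theorem conj_mem_GLInt {τ : F} (hτ : IsOrthoGen p τ) {A : Fˣ} (hA : ‖(A : F)‖ ≤ 1) {α : F}
    (hα : ‖α‖ = 1) {γ : GL (Fin 2) ℚ_[p]} (hγ : IsMulMatrix τ α γ.1)
    (hγ' : IsMulMatrix τ α⁻¹ (γ⁻¹).1) :
    (triang A 1 τ)⁻¹ * Matrix.GeneralLinearGroup.map (algebraMap ℚ_[p] F) γ * triang A 1 τ ∈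
      GLInt p F := by
  have hu := IsUltrametricDist.of_normedAlgebra ℚ_[p] (L := F)
  have key : ∀ (β : F), ‖β‖ = 1 → ∀ γ : GL (Fin 2) ℚ_[p], IsMulMatrix τ β γ.1 → ∀ i j,
      ‖((triang A 1 τ)⁻¹ * Matrix.GeneralLinearGroup.map (algebraMap ℚ_[p] F) γ *
        triang A 1 τ).1 i j‖ ≤ 1 := by
    intro β hβ γ hγ
    have h0 := hγ.row_zero
    have h1 := hγ.row_one
    have hn0 := hτ.norm_eq (γ.1 0 0) (γ.1 0 1)
    have hn1 := hτ.norm_eq (γ.1 1 0) (γ.1 1 1)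
    rw [h0, norm_mul, hβ, hτ.norm_gen, one_mul] at hn0
    rw [h1, hβ] at hn1
    have hm00 : ‖γ.1 0 0‖ ≤ 1 := hn0 ▸ le_max_left _ _
    have hm10 : ‖γ.1 1 0‖ ≤ 1 := hn1 ▸ le_max_left _ _
    set m : Matrix (Fin 2) (Fin 2) F := (γ.1).map (algebraMap ℚ_[p] F) with hm
    -- The column (τ, 1) is an eigenvector of m with eigenvalue β, and it is the second column of
    -- `triang A 1 τ`; hence the conjugate is lower triangular. Its corner m₁₀A is where |A| ≤ 1
    -- enters.
    have hmat : ((triang A 1 τ)⁻¹ * Matrix.GeneralLinearGroup.map (algebraMap ℚ_[p] F) γ *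
        triang A 1 τ).1 = !![m 0 0 - τ * m 1 0, 0; m 1 0 * A, β] := by
      rw [Units.val_mul, Units.val_mul, coe_triang_inv, coe_triang]
      change _ * m * _ = _
      have e0 : m 0 0 * τ + m 0 1 = β * τ := h0
      have e1 : m 1 0 * τ + m 1 1 = β := h1
      rw [Matrix.eta_fin_two m, Matrix.mul_fin_two, Matrix.mul_fin_two]
      have hA0 : (A : F) ≠ 0 := A.ne_zero
      ext i j
      fin_cases i <;> fin_cases j <;> simp
      · field_simp
        ring
      · field_simp
        linear_combination e0 - τ * e1
      · exact e1
    rw [hmat]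
    intro i j
    fin_cases i <;> fin_cases j
    · change ‖m 0 0 - τ * m 1 0‖ ≤ 1
      rw [sub_eq_add_neg]
      refine (IsUltrametricDist.norm_add_le_max _ _).trans (max_le ?_ ?_)
      · exact (norm_algebraMap_padic _).trans_le hm00
      · rw [norm_neg, norm_mul, hτ.norm_gen, one_mul]
        exact (norm_algebraMap_padic _).trans_le hm10
    · simp
    · change ‖m 1 0 * A‖ ≤ 1
      rw [norm_mul]
      exact mul_le_one₀ ((norm_algebraMap_padic _).trans_le hm10) (norm_nonneg _) hA
    · exact hβ.le
  rw [mem_GLInt_iff]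
  refine ⟨key α hα γ hγ, ?_⟩
  have hinv : ((triang A 1 τ)⁻¹ * Matrix.GeneralLinearGroup.map (algebraMap ℚ_[p] F) γ *
      triang A 1 τ)⁻¹ = (triang A 1 τ)⁻¹ *
      Matrix.GeneralLinearGroup.map (algebraMap ℚ_[p] F) γ⁻¹ * triang A 1 τ := by
    rw [map_inv]; simp [mul_assoc]
  rw [hinv]
  exact key α⁻¹ (by rw [norm_inv, hα, inv_one]) γ⁻¹ hγ'

end IsOrthoGen

variable (F) in
/-- The unit of `F` given by a unit of `ℚ_p`. -/
def unitMap (a : ℚ_[p]ˣ) : Fˣ := Units.map (algebraMap ℚ_[p] F : ℚ_[p] →* F) a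

theorem coe_unitMap (a : ℚ_[p]ˣ) : (unitMap F a : F) = algebraMap ℚ_[p] F a := rfl

theorem norm_unitMap (a : ℚ_[p]ˣ) : ‖(unitMap F a : F)‖ = ‖(a : ℚ_[p])‖ :=
  norm_algebraMap_padic (a : ℚ_[p])

theorem map_triang_padic (a d : ℚ_[p]ˣ) (x : ℚ_[p]) :
    Matrix.GeneralLinearGroup.map (algebraMap ℚ_[p] F) (triang a d x) =
      triang (unitMap F a) (unitMap F d) (algebraMap ℚ_[p] F x) := map_triang _ a d x

/-- With x = τ, an upper right entry uτ + w becomes τ after a left translation over ℚ_p, at the cost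
of dividing A by u. -/
theorem triang_eq_map_mul (u : ℚ_[p]ˣ) (w : ℚ_[p]) (A : Fˣ) (x : F) :
    triang A 1 (algebraMap ℚ_[p] F u * x + algebraMap ℚ_[p] F w) =
      Matrix.GeneralLinearGroup.map (algebraMap ℚ_[p] F) (triang u 1 w) *
        triang ((unitMap F u)⁻¹ * A) 1 x := by
  rw [map_triang_padic, triang_mul, mul_inv_cancel_left, mul_one, Units.val_one, mul_one,
    coe_unitMap]
  congr 1
  simp [unitMap]

end Level

/-! ### Reduction to the single test function ch(ℤ_p²). -/

section Main

variable {p : ℕ} [Fact p.Prime] {F : Type*} [NormedField F] [NormedAlgebra ℚ_[p] F]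
  [FiniteDimensional ℚ_[p] F] [MeasurableSpace (GL (Fin 2) F)] [BorelSpace (GL (Fin 2) F)]
  {N : Submodule (HeckeAlg (level p F))
    (CoinvModule p (Matrix.GeneralLinearGroup.map (algebraMap ℚ_[p] F)) (level p F))}

/-- If the class of `ch(ℤ_p²) ⊗ ch(g K)` lies in `N`, for `g = (A, τ; 0, 1)` with `A` integral,
then so do all classes `φ ⊗ ch(g K)`. -/
theorem IsOrthoGen.good_of_chZp {τ : F} (hτ : IsOrthoGen p τ) {A : Fˣ} (hA : ‖(A : F)‖ ≤ 1)
    (h : classMod N (chZp p) (chCoset (level p F) (triang A 1 τ)) = 0) :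
    Good N (triang A 1 τ) := by
  classical
  have hl := functional_eq_zero ((classMod N).flip (chCoset (level p F) (triang A 1 τ))) ?_ ?_
  · exact fun φ => LinearMap.congr_fun hl φ
  · intro a
    -- A ball around 0 is a scalar dilate of ℤ_p². The scalar moves to the coset, where it is
    -- central and is absorbed by a Hecke operator.
    have hb : chBall p a 0 = schwartzRep p (triang a a 0)⁻¹ (chZp p) := by
      refine Subtype.ext <| funext fun v => ?_
      rw [schwartzRep_apply, chBall_apply, chZp_apply, sub_zero]
      have hv : Matrix.vecMul v (((triang a a 0)⁻¹ : GL (Fin 2) ℚ_[p])).1 =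
          (a : ℚ_[p])⁻¹ • v := by
        rw [coe_triang_inv]
        funext j
        fin_cases j <;> simp [Matrix.vecMul, dotProduct, Fin.sum_univ_two, mul_comm]
      rw [hv, norm_smul, norm_inv]
      have ha : 0 < ‖(a : ℚ_[p])‖ := norm_pos_iff.2 a.ne_zero
      exact if_congr (by rw [inv_mul_le_iff₀ ha, mul_one]) rfl rfl
    rw [LinearMap.flip_apply, hb, ← classMod_chCoset_left, map_triang_padic, map_zero,
      triang_scalar_comm]
    exact classMod_mul_central (triang_scalar_comm _) h
  · intro v w hvw
    rcases eq_or_ne w 0 with rfl | hw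
    · have hv : v = 0 := by rwa [norm_zero, norm_eq_zero] at hvw
      exact ⟨1, by simp [hv], by simp, by simp⟩
    · have hw0 : ‖evalVec τ w‖ ≠ 0 := by rw [hτ.norm_evalVec]; exact norm_ne_zero_iff.2 hw
      have hv0 : ‖evalVec τ v‖ ≠ 0 := by
        rwa [hτ.norm_evalVec, hvw, ← hτ.norm_evalVec]
      -- Multiplication by the unit α = w/v of O_F carries v to w and preserves norms; it stabilises
      -- the coset, so the functional is invariant under it.
      set α := evalVec τ w / evalVec τ v with hα
      have hα1 : ‖α‖ = 1 := by
        rw [hα, norm_div, hτ.norm_evalVec, hτ.norm_evalVec, hvw,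
          div_self (norm_ne_zero_iff.2 hw)]
      have hα0 : α ≠ 0 := norm_ne_zero_iff.1 (by rw [hα1]; exact one_ne_zero)
      obtain ⟨γ, hγ, hγ'⟩ := hτ.exists_isMulMatrix_unit hα0
      refine ⟨γ, hτ.evalVec_injective ?_, fun u => ?_, fun φ => ?_⟩
      · rw [hγ, hα, div_mul_cancel₀ _ (norm_ne_zero_iff.1 hv0)]
      · rw [← hτ.norm_evalVec, hγ, norm_mul, hα1, one_mul, hτ.norm_evalVec]
      · rw [LinearMap.flip_apply, LinearMap.flip_apply, ← classMod_rep N γ φ, leftRep_chCoset,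
          ← chCoset_mul_mem (level p F) (triang A 1 τ) (hτ.conj_mem_GLInt hA hα1 hγ hγ')]
        simp [mul_assoc]

/-- A is an element of ℚ_p^× times a unit: the first factor translates on the left, the second lies
in K. -/
theorem good_triang_of_good_one (hval : ∀ x : Fˣ, ∃ a : ℚ_[p]ˣ, ‖(a : ℚ_[p])‖ = ‖(x : F)‖)
    (h : Good N 1) (A : Fˣ) : Good N (triang A 1 0) := by
  obtain ⟨a, ha⟩ := hval A
  have := good_right (good_left (triang a 1 0) h) (k := triang ((unitMap F a)⁻¹ * A) 1 0)
    (triang_mem_GLInt (by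
      rw [Units.val_mul, Units.val_inv_eq_inv_val, norm_mul, norm_inv, norm_unitMap, ha,
        inv_mul_cancel₀ (norm_ne_zero_iff.2 A.ne_zero)]) (by simp) (by simp))
  rw [mul_one, map_triang_padic, triang_mul] at this
  convert this using 2
  · exact (mul_inv_cancel_left (unitMap F a) A).symm
  · simp [unitMap]
  · simp

end Main

/-! ### Induction on the valuation of A, and conclusion. -/

section Induction

variable {p : ℕ} [Fact p.Prime]

theorem schwartzRep_chZp {u : ℚ_[p]ˣ} (hu : ‖(u : ℚ_[p])‖ = 1) {w : ℚ_[p]} (hw : ‖w‖ ≤ 1) :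
    schwartzRep p (triang u 1 w) (chZp p) = chZp p := by
  classical
  refine Subtype.ext <| funext fun v => ?_
  rw [schwartzRep_apply, chZp_apply, chZp_apply]
  have h0 : Matrix.vecMul v (triang u 1 w).1 0 = v 0 * u := by
    simp [coe_triang, Matrix.vecMul, dotProduct, Fin.sum_univ_two]
  have h1 : Matrix.vecMul v (triang u 1 w).1 1 = v 0 * w + v 1 := by
    simp [coe_triang, Matrix.vecMul, dotProduct, Fin.sum_univ_two]
  refine if_congr ?_ rfl rfl
  rw [pi_norm_le_iff_of_nonneg zero_le_one, pi_norm_le_iff_of_nonneg zero_le_one,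
    Fin.forall_fin_two, Fin.forall_fin_two, h0, h1, norm_mul, hu, mul_one]
  refine and_congr_right fun hv => ?_
  have hvw : ‖v 0 * w‖ ≤ 1 := by
    rw [norm_mul]; exact mul_le_one₀ hv (norm_nonneg _) hw
  constructor
  · intro h
    have := (IsUltrametricDist.norm_add_le_max (-(v 0 * w)) (v 0 * w + v 1)).trans
      (max_le (by rwa [norm_neg]) h)
    rwa [neg_add_cancel_left] at this
  · exact fun h => (IsUltrametricDist.norm_add_le_max _ _).trans (max_le hvw h)

variable {F : Type*} [NormedField F] [NormedAlgebra ℚ_[p] F]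
  [FiniteDimensional ℚ_[p] F]

/-- The coset of (A, x; 0, 1) depends only on |A| and on x modulo A·O_F. -/
theorem chCoset_triang_congr {A A' : Fˣ} {x x' : F} (hA : ‖(A' : F)‖ = ‖(A : F)‖)
    (hx : ‖x' - x‖ ≤ ‖(A : F)‖) :
    chCoset (level p F) (triang A' 1 x') = chCoset (level p F) (triang A 1 x) := by
  have hA0 : ‖(A : F)‖ ≠ 0 := norm_ne_zero_iff.2 A.ne_zero
  have hk : triang (A⁻¹ * A') 1 ((A : F)⁻¹ * (x' - x)) ∈ (level p F).toSubgroup := by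
    refine triang_mem_GLInt ?_ (by simp) ?_
    · rw [Units.val_mul, Units.val_inv_eq_inv_val, norm_mul, norm_inv, hA, inv_mul_cancel₀ hA0]
    · rw [norm_mul, norm_inv, inv_mul_le_iff₀ (lt_of_le_of_ne (norm_nonneg _) hA0.symm), mul_one]
      exact hx
  rw [← chCoset_mul_mem (level p F) (triang A 1 x) hk, triang_mul, mul_inv_cancel_left, mul_one,
    mul_inv_cancel_left₀ A.ne_zero, Units.val_one, mul_one, sub_add_cancel]

variable [MeasurableSpace (GL (Fin 2) F)] [BorelSpace (GL (Fin 2) F)]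
  {N : Submodule (HeckeAlg (level p F))
    (CoinvModule p (Matrix.GeneralLinearGroup.map (algebraMap ℚ_[p] F)) (level p F))}

/-- A scalar of F is a scalar of ℚ_p, moved to the left by centrality, times a unit scalar in K. -/
theorem good_mul_scalar (hval : ∀ x : Fˣ, ∃ a : ℚ_[p]ˣ, ‖(a : ℚ_[p])‖ = ‖(x : F)‖)
    {g : GL (Fin 2) F} (h : Good N g) (d : Fˣ) : Good N (g * triang d d 0) := by
  obtain ⟨e, he⟩ := hval d
  have hn : ‖(((unitMap F e)⁻¹ * d : Fˣ) : F)‖ = 1 := by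
    rw [Units.val_mul, Units.val_inv_eq_inv_val, norm_mul, norm_inv, norm_unitMap, he,
      inv_mul_cancel₀ (norm_ne_zero_iff.2 d.ne_zero)]
  have := good_right (good_left (triang e e 0) h)
    (triang_mem_GLInt (p := p) hn hn (x := 0) (by simp))
  rw [map_triang_padic, map_zero, triang_scalar_comm, mul_assoc, triang_mul,
    mul_inv_cancel_left] at this
  simpa using this

namespace IsOrthoGen

variable {τ : F}

/-- As τ is integral, (1, τ; 0, 1) lies in K, so the unit-group symmetry of the cosets g_A K with A
= 1 applies to K itself. -/
theorem good_one (hτ : IsOrthoGen p τ)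
    (h : coinvClass p (Matrix.GeneralLinearGroup.map (algebraMap ℚ_[p] F)) (level p F) (chZp p)
      (chLevel (level p F)) ∈ N) : Good N 1 := by
  have he : chCoset (level p F) (triang 1 1 τ) = chCoset (level p F) 1 := by
    rw [← triang_one]
    exact chCoset_triang_congr rfl (by simp [hτ.norm_gen])
  have := hτ.good_of_chZp (N := N) (A := 1) (by simp)
    (by rw [he, chCoset_one]; exact (classMod_eq_zero N).2 h)
  exact fun φ => he ▸ this φ

/-- The cosets in `g K (p, 0; 0, 1) K`, for `g = (p ^ n, τ; 0, 1)`: each contributes the class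
attached to `(p ^ (n + 1), τ; 0, 1)` or one that is already known to vanish. -/
theorem classMod_coset (hτ : IsOrthoGen p τ) (h1 : Good N 1) {n : ℕ}
    (ih : ∀ A : Fˣ, ‖(p : ℚ_[p]) ^ n‖ ≤ ‖(A : F)‖ → Good N (triang A 1 τ))
    {B P : Fˣ} (hB : (B : F) = algebraMap ℚ_[p] F ((p : ℚ_[p]) ^ n))
    (hP : ‖(P : F)‖ = ‖(p : ℚ_[p])‖) {a d : Fˣ} {x : F} (ha : ‖(a : F)‖ ≤ 1)
    (hd : ‖(d : F)‖ ≤ 1) (hx : ‖x‖ ≤ 1) (had : ‖(a : F)‖ * ‖(d : F)‖ = ‖(p : ℚ_[p])‖) :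
    classMod N (chZp p) (chCoset (level p F) (triang B 1 τ * triang a d x)) = 0 ∨
      classMod N (chZp p) (chCoset (level p F) (triang B 1 τ * triang a d x)) =
        classMod N (chZp p) (chCoset (level p F) (triang (B * P) 1 τ)) := by
  have hp0 : 0 < ‖(p : ℚ_[p])‖ :=
    norm_pos_iff.2 (Nat.cast_ne_zero.2 (Fact.out : p.Prime).ne_zero)
  have hBn : ‖(B : F)‖ = ‖(p : ℚ_[p]) ^ n‖ := by rw [hB, norm_algebraMap_padic]
  have hB1 : ‖(p : ℚ_[p]) ^ n‖ ≤ 1 := by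
    rw [norm_pow]; exact pow_le_one₀ (norm_nonneg _) Padic.norm_p_lt_one.le
  have hd0 : 0 < ‖(d : F)‖ := norm_pos_iff.2 d.ne_zero
  have hxd : ((B : F) * x + τ * d) * (d : F)⁻¹ = B * (x * (d : F)⁻¹) + τ := by
    rw [add_mul, mul_assoc, mul_inv_cancel_right₀ d.ne_zero]
  rw [triang_mul, one_mul, triang_eq_mul_scalar, hxd]
  have hBa : ‖((B * a * d⁻¹ : Fˣ) : F)‖ = ‖(B : F)‖ * ‖(a : F)‖ * ‖(d : F)‖⁻¹ := by simp
  -- If |d| < 1 then |d| = |p| and |a| = 1. Removing the scalar d leaves a diagonal entry larger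
  -- than pⁿ, which absorbs Bx/d, and the induction hypothesis applies.
  rcases hd.lt_or_eq with hlt | heq
  · left
    refine good_mul_scalar hτ.val (fun φ => ?_) d (chZp p)
    have hdp : ‖(d : F)‖ ≤ ‖(p : ℚ_[p])‖ := by
      obtain ⟨e, he⟩ := hτ.val d
      rw [← he] at hlt ⊢
      have h := padic_norm_le_of_lt (a := 1) (by simpa using hlt)
      rwa [mul_one] at h
    have ha1 : ‖(a : F)‖ = 1 := by
      refine le_antisymm ha ?_
      by_contra hlt'
      rw [not_le] at hlt'
      exact absurd had (((mul_lt_mul_of_pos_right hlt' hd0).trans_le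
        ((one_mul _).trans_le hdp)).ne)
    rw [chCoset_triang_congr (A := B * a * d⁻¹) (x := τ) rfl]
    · refine ih _ ?_ φ
      rw [hBa, hBn, ha1, mul_one]
      exact le_mul_of_one_le_right (norm_nonneg _) ((one_le_inv₀ hd0).2 hd)
    · rw [add_sub_cancel_right, hBa, ha1, mul_one, norm_mul, norm_mul, norm_inv, ← mul_assoc]
      exact mul_le_mul_of_nonneg_right (mul_le_of_le_one_right (norm_nonneg _) hx)
        (inv_nonneg.2 (norm_nonneg _))
  -- If |d| = 1, the diagonal entry has norm |pⁿ⁺¹| and the corner is uτ + pⁿw with u = 1 + pⁿy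
  -- integral. The cases are u = 0 (a translate of a diagonal coset), 0 < |u| < 1 (dividing A by u
  -- enlarges it) and |u| = 1.
  · rw [heq, mul_one] at had
    have hA : ‖((B * a * d⁻¹ : Fˣ) : F)‖ = ‖(p : ℚ_[p]) ^ (n + 1)‖ := by
      rw [hBa, heq, hBn, had, inv_one, mul_one, pow_succ, norm_mul]
    rw [chCoset_mul_mem _ _ (triang_mem_GLInt (p := p) heq heq (x := 0) (by simp))]
    set A := B * a * d⁻¹
    obtain ⟨y, w, hyw⟩ := hτ.span (x * (d : F)⁻¹)
    have hmax : max ‖y‖ ‖w‖ ≤ 1 := by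
      rw [← hτ.norm_eq, ← hyw, norm_mul, norm_inv, heq, inv_one, mul_one]
      exact hx
    have hsplit : (B : F) * (x * (d : F)⁻¹) + τ =
        algebraMap ℚ_[p] F (1 + (p : ℚ_[p]) ^ n * y) * τ +
          algebraMap ℚ_[p] F ((p : ℚ_[p]) ^ n * w) := by
      rw [hyw, hB]; simp only [map_add, map_mul, map_one]; ring
    have hw : ‖(p : ℚ_[p]) ^ n * w‖ ≤ 1 := by
      rw [norm_mul]; exact mul_le_one₀ hB1 (norm_nonneg _) ((le_max_right _ _).trans hmax)
    have hu : ‖1 + (p : ℚ_[p]) ^ n * y‖ ≤ 1 := by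
      refine (IsUltrametricDist.norm_add_le_max _ _).trans (max_le norm_one.le ?_)
      rw [norm_mul]; exact mul_le_one₀ hB1 (norm_nonneg _) ((le_max_left _ _).trans hmax)
    rw [hsplit]
    rcases eq_or_ne (1 + (p : ℚ_[p]) ^ n * y) 0 with h0 | h0
    · left
      have := good_left (triang 1 1 ((p : ℚ_[p]) ^ n * w))
        (good_triang_of_good_one hτ.val h1 A) (chZp p)
      rw [h0, map_zero, zero_mul]
      rwa [map_triang_padic, triang_mul, show unitMap F 1 = 1 from map_one _, one_mul, one_mul,
        mul_zero, Units.val_one, mul_one] at this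
    · rw [← Units.val_mk0 h0, triang_eq_map_mul]
      have hn : ‖(((unitMap F (Units.mk0 _ h0))⁻¹ * A : Fˣ) : F)‖ =
          ‖1 + (p : ℚ_[p]) ^ n * y‖⁻¹ * ‖(A : F)‖ := by
        rw [Units.val_mul, Units.val_inv_eq_inv_val, norm_mul, norm_inv, norm_unitMap,
          Units.val_mk0]
      rcases hu.lt_or_eq with hlt | hu1
      · left
        refine good_left _ (ih _ (hτ.le_norm_of_lt ?_)) _
        rw [hn, ← hA]
        refine lt_mul_of_one_lt_left (norm_pos_iff.2 A.ne_zero) ?_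
        exact (one_lt_inv₀ (norm_pos_iff.2 h0)).2 hlt
      · right
        -- For |u| = 1 the translating matrix lies in GL₂(ℤ_p), so it fixes ch(ℤ_p²). This step
        -- needs that particular φ.
        have hfix := schwartzRep_chZp (u := Units.mk0 _ h0) hu1 hw
        have hfix' : schwartzRep p (triang (Units.mk0 _ h0) 1 ((p : ℚ_[p]) ^ n * w))⁻¹ (chZp p) =
            chZp p := by
          conv_lhs => rw [← hfix]
          rw [← Module.End.mul_apply, ← map_mul, inv_mul_cancel, map_one, Module.End.one_apply]
        rw [classMod_chCoset_left, hfix',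
          chCoset_triang_congr (A := B * P) (x := τ) _ (by simp)]
        rw [hn, hu1, inv_one, one_mul, hA, Units.val_mul, norm_mul, hBn, hP, pow_succ, norm_mul]

theorem good_triang (hτ : IsOrthoGen p τ) (h1 : Good N 1) (n : ℕ) :
    ∀ A : Fˣ, ‖(p : ℚ_[p]) ^ n‖ ≤ ‖(A : F)‖ → Good N (triang A 1 τ) := by
  have hp0 : (p : ℚ_[p]) ≠ 0 := Nat.cast_ne_zero.2 (Fact.out : p.Prime).ne_zero
  induction n with
  | zero =>
    intro A hA φ
    -- For n = 0, |A| ≥ 1 = |τ|, so τ is absorbed into A·O_F.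
    rw [chCoset_triang_congr (A := A) (x := 0) rfl (by simpa [hτ.norm_gen] using hA)]
    exact good_triang_of_good_one hτ.val h1 A φ
  | succ n ih =>
    intro A hA
    rcases hA.lt_or_eq with hlt | heq
    · exact ih A (hτ.le_norm_of_lt hlt)
    · set B : Fˣ := unitMap F (Units.mk0 ((p : ℚ_[p]) ^ n) (pow_ne_zero n hp0)) with hB
      set P : Fˣ := unitMap F (Units.mk0 (p : ℚ_[p]) hp0) with hP
      have hPn : ‖(P : F)‖ = ‖(p : ℚ_[p])‖ := norm_unitMap _
      have hBn : ‖(B : F)‖ = ‖(p : ℚ_[p]) ^ n‖ := norm_unitMap _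
      have hBP : ‖((B * P : Fˣ) : F)‖ = ‖(A : F)‖ := by
        rw [Units.val_mul, norm_mul, hPn, hBn, ← norm_mul, ← pow_succ, heq]
      have hgc : triang B 1 τ * triang P 1 0 = triang (B * P) 1 τ := by
        rw [triang_mul]; simp
      have hc : ‖(((triang P 1 0 : GL (Fin 2) F)) : Matrix (Fin 2) (Fin 2) F).det‖ =
          ‖(p : ℚ_[p])‖ := by
        rw [coe_triang, Matrix.det_fin_two_of]; simpa using hPn
      have hgood : Good N (triang (B * P) 1 τ) := by
        refine hτ.good_of_chZp ?_ ?_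
        · rw [hBP, ← heq, norm_pow]
          exact pow_le_one₀ (norm_nonneg _) Padic.norm_p_lt_one.le
        · rw [← hgc]
          -- The operator is that of c = diag(p, 1). Each k c is put in Iwasawa form (a, x; 0, d),
          -- which is still integral with determinant of norm |p|.
          refine classMod_double_coset (ih B hBn.ge (chZp p)) fun k hk => ?_
          obtain ⟨a, d, x, k', hk', he⟩ := exists_triang_mul (p := p) (k * triang P 1 0)
          rw [he, ← mul_assoc, chCoset_mul_mem _ _ hk', hgc]
          have he' : triang a d x = k * triang P 1 0 * k'⁻¹ := by rw [he, mul_inv_cancel_right]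
          have hdet : ‖(a : F)‖ * ‖(d : F)‖ = ‖(p : ℚ_[p])‖ := by
            have := congrArg (fun g : GL (Fin 2) F => ‖g.1.det‖) he'
            simp only [Units.val_mul, Matrix.det_mul, norm_mul, hc,
              norm_det_of_mem_GLInt (p := p) hk,
              norm_det_of_mem_GLInt (p := p) (inv_mem hk')] at this
            rw [coe_triang, Matrix.det_fin_two_of] at this
            simpa using this
          have hint : ∀ i j, ‖(triang a d x).1 i j‖ ≤ 1 := by
            have hmul : ∀ M M' : Matrix (Fin 2) (Fin 2) F, (∀ i j, ‖M i j‖ ≤ 1) →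
                (∀ i j, ‖M' i j‖ ≤ 1) → ∀ i j, ‖(M * M') i j‖ ≤ 1 := by
              have hu := IsUltrametricDist.of_normedAlgebra ℚ_[p] (L := F)
              intro M M' hM hM' i j
              rw [Matrix.mul_apply, Fin.sum_univ_two]
              refine (IsUltrametricDist.norm_add_le_max _ _).trans (max_le ?_ ?_)
              · rw [norm_mul]; exact mul_le_one₀ (hM _ _) (norm_nonneg _) (hM' _ _)
              · rw [norm_mul]; exact mul_le_one₀ (hM _ _) (norm_nonneg _) (hM' _ _)
            rw [he']
            refine hmul _ _ (hmul _ _ ((mem_GLInt_iff p k).1 hk).1 fun i j => ?_)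
              ((mem_GLInt_iff p k').1 hk').2
            have hP1 : ‖(P : F)‖ ≤ 1 := hPn ▸ Padic.norm_p_lt_one.le
            rw [coe_triang]
            fin_cases i <;> fin_cases j <;> simp [hP1]
          exact hτ.classMod_coset h1 ih rfl hPn (by simpa [coe_triang] using hint 0 0)
            (by simpa [coe_triang] using hint 1 1) (by simpa [coe_triang] using hint 0 1) hdet
      intro φ
      rw [chCoset_triang_congr (A := B * P) (x := τ) hBP.symm (by simp)]
      exact hgood φ

theorem good_all (hτ : IsOrthoGen p τ) (h1 : Good N 1) (g : GL (Fin 2) F) : Good N g := by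
  obtain ⟨a, d, x, k, hk, rfl⟩ := exists_triang_mul (p := p) g
  refine good_right ?_ hk
  rw [triang_eq_mul_scalar]
  refine good_mul_scalar hτ.val ?_ d
  obtain ⟨y, w, hyw⟩ := hτ.span (x * (d : F)⁻¹)
  rw [hyw]
  rcases eq_or_ne y 0 with rfl | hy
  · have := good_left (triang 1 1 w) (good_triang_of_good_one hτ.val h1 (a * d⁻¹))
    rw [map_zero, zero_mul]
    rwa [map_triang_padic, triang_mul, show unitMap F 1 = 1 from map_one _, one_mul, one_mul,
      mul_zero, Units.val_one, mul_one] at this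
  · rw [← Units.val_mk0 hy, triang_eq_map_mul]
    set A := (unitMap F (Units.mk0 y hy))⁻¹ * (a * d⁻¹)
    -- Any n with |pⁿ| below |A| brings A into the range of the induction.
    obtain ⟨n, hn⟩ := exists_pow_lt_of_lt_one (norm_pos_iff.2 A.ne_zero)
      (Padic.norm_p_lt_one (p := p))
    exact good_left _ (hτ.good_triang h1 n A (by rw [norm_pow]; exact hn.le))

end IsOrthoGen

end Induction

end

end AsaiHecke

theorem corollary3p2 (p : ℕ) [Fact p.Prime] (hp : p ≠ 2)
    (F : Type*) [NormedField F] [NormedAlgebra ℚ_[p] F] [FiniteDimensional ℚ_[p] F]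
    (hdeg : Module.finrank ℚ_[p] F = 2) (hunr : AsaiHecke.IsUnramified p F)
    [MeasurableSpace (GL (Fin 2) F)] [BorelSpace (GL (Fin 2) F)] :
    Submodule.span (AsaiHecke.HeckeAlg (AsaiHecke.level p F))
      {AsaiHecke.coinvClass p (Matrix.GeneralLinearGroup.map (algebraMap ℚ_[p] F))
        (AsaiHecke.level p F) (AsaiHecke.chZp p) (AsaiHecke.chLevel (AsaiHecke.level p F))} = ⊤ := by
  obtain ⟨τ, hτ⟩ := AsaiHecke.exists_isOrthoGen hdeg hunr
  exact AsaiHecke.eq_top_of_forall_good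
    (hτ.good_all (hτ.good_one (Submodule.mem_span_singleton_self _)))
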